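/- For $s>0$ and $1\le q<\infty$, let $W^{s,q}(\mathbb R^n)$, $n\ge 1$, be the space of all functions $f\in L^q(\mathbb R^n)$ such that $(I-\Delta)^{s/2}f=\mathscr F^{-1}\big((1+4\pi^2|\xi|^2)^{s/2}\,\mathscr F f\big)$, taken in the sense of tempered distributions with $\mathscr F f(\xi)=\int_{\mathbb R^n} e^{-2\pi i x\cdot\xi}f(x)\,dx$, belongs to $L^q(\mathbb R^n)$, with norm $\|f\|_{W^{s,q}}=\|(I-\Delta)^{s/2}f\|_{L^q}$. For $\delta\in\mathbb C$ let $(1-|x|^2)_+^\delta$ denote the function equal to $(1-|x|^2)^\delta$ for $|x|<1$ and to $0$ for $|x|\ge 1$. Let $n\ge 1$, $1\le q<\infty$ and $s>0$. (i) If $\delta=\sigma+i\tau$ with $\sigma,\tau\in\mathbb R$ and $s<\sigma+\frac1q$, then $(1-|x|^2)_+^\delta\in W^{s,q}(\mathbb R^n)$. (ii) There is a constant $c>0$, depending only on $n$, $q$ and $s$, such that for all real $\sigma_0>s-\frac1q$ and $c'$ there is a constant $C>0$, depending only on $n$, $q$, $s$, $\sigma_0$ and $c'$, with $$\big\|(1-|x|^2)_+^{\sigma+i\tau}\big\|_{W^{s,q}(\mathbb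 R^n)}\le C\,e^{c|\tau|}\qquad\text{for all } \sigma\in[\sigma_0,c'] \text{ and } \tau\in\mathbb R.$$ -/

import Mathlib

open MeasureTheory
open scoped ENNReal SchwartzMap

noncomputable section

namespace BochnerRiesz

/-- The symbol `(1 + 4π²|ξ|²)^{s/2}` on `ℝⁿ`. -/
def besselSymbol (n : ℕ) (s : ℝ) (ξ : EuclideanSpace ℝ (Fin n)) : ℝ :=
  (1 + 4 * Real.pi ^ 2 * ‖ξ‖ ^ 2) ^ (s / 2)

/-- The symbol is smooth with polynomially bounded derivatives, so that Mathlib's Fourier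
multiplier with this symbol is the genuine one (it is zero for symbols without this property). -/
theorem besselSymbol_hasTemperateGrowth (n : ℕ) (s : ℝ) :
    (fun ξ ↦ (besselSymbol n s ξ : ℂ)).HasTemperateGrowth := by
  have h1 := Function.hasTemperateGrowth_one_add_norm_sq_rpow (EuclideanSpace ℝ (Fin n)) (s / 2)
  have h2 : (fun ξ : EuclideanSpace ℝ (Fin n) ↦ (2 * Real.pi) • ξ).HasTemperateGrowth :=
    ((2 * Real.pi) • ContinuousLinearMap.id ℝ (EuclideanSpace ℝ (Fin n))).hasTemperateGrowth
  have h3 := h1.comp h2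
  have h4 : ((fun x : EuclideanSpace ℝ (Fin n) ↦ (1 + ‖x‖ ^ 2) ^ (s / 2)) ∘
      fun ξ ↦ (2 * Real.pi) • ξ) = besselSymbol n s := by
    funext ξ
    simp only [Function.comp, besselSymbol, norm_smul, mul_pow, Real.norm_eq_abs, sq_abs]
    norm_num
  rw [h4] at h3
  fun_prop

/-- The operator `(I - Δ)^{s/2} u = 𝓕⁻¹ ((1 + 4π²|ξ|²)^{s/2} 𝓕 u)` on tempered distributions
on `ℝⁿ`, with `𝓕 f(ξ) = ∫ e^{-2πi x·ξ} f(x) dx`. -/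
def besselOp (n : ℕ) (s : ℝ) :
    𝓢'(EuclideanSpace ℝ (Fin n), ℂ) →L[ℂ] 𝓢'(EuclideanSpace ℝ (Fin n), ℂ) :=
  TemperedDistribution.fourierMultiplierCLM ℂ (fun ξ ↦ (besselSymbol n s ξ : ℂ))

/-- `f` is a function in `L^q(ℝⁿ)` and `(I - Δ)^{s/2} f`, computed in the sense of tempered
distributions, is the `L^q` function `g`. -/
def IsBesselImage (n : ℕ) (s : ℝ) (q : ℝ≥0∞) [Fact (1 ≤ q)]
    (f : EuclideanSpace ℝ (Fin n) → ℂ)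
    (g : Lp ℂ q (volume : Measure (EuclideanSpace ℝ (Fin n)))) : Prop :=
  ∃ hf : MemLp f q volume,
    besselOp n s (Lp.toTemperedDistribution (hf.toLp f)) = Lp.toTemperedDistribution g

/-- Membership of a function in the Sobolev space `W^{s,q}(ℝⁿ)`, for `s ≥ 0`
(for these `s` every element of the space is a function in `L^q`). -/
def MemSobolevW (n : ℕ) (s : ℝ) (q : ℝ≥0∞) [Fact (1 ≤ q)]
    (f : EuclideanSpace ℝ (Fin n) → ℂ) : Prop :=
  ∃ g : Lp ℂ q (volume : Measure (EuclideanSpace ℝ (Fin n))), IsBesselImage n s q f g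

/-- The norm `‖f‖_{W^{s,q}} = ‖(I - Δ)^{s/2} f‖_{L^q}`, with value `∞` if `f ∉ W^{s,q}(ℝⁿ)`.
The infimum is over at most one `g`, see `sobolevNormW_eq`. -/
def sobolevNormW (n : ℕ) (s : ℝ) (q : ℝ≥0∞) [Fact (1 ≤ q)]
    (f : EuclideanSpace ℝ (Fin n) → ℂ) : ℝ≥0∞ :=
  ⨅ (g : Lp ℂ q (volume : Measure (EuclideanSpace ℝ (Fin n)))) (_ : IsBesselImage n s q f g), ‖g‖ₑ

theorem sobolevNormW_eq {n : ℕ} {s : ℝ} {q : ℝ≥0∞} [Fact (1 ≤ q)]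
    {f : EuclideanSpace ℝ (Fin n) → ℂ}
    {g : Lp ℂ q (volume : Measure (EuclideanSpace ℝ (Fin n)))} (hg : IsBesselImage n s q f g) :
    sobolevNormW n s q f = ‖g‖ₑ := by
  apply le_antisymm (iInf₂_le g hg)
  refine le_iInf₂ fun g' hg' ↦ ?_
  obtain ⟨_, h⟩ := hg
  obtain ⟨_, h'⟩ := hg'
  have hinj := LinearMap.ker_eq_bot.mp
    (Lp.ker_toTemperedDistributionCLM_eq_bot (F := ℂ) (p := q)
      (μ := (volume : Measure (EuclideanSpace ℝ (Fin n)))))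
  have : g = g' := hinj (h.symm.trans h')
  rw [this]

/-- The function `(1 - |x|²)_+^δ` on `ℝⁿ`: equal to `(1 - |x|²)^δ = e^{δ log (1 - |x|²)}` for
`|x| < 1` and to `0` for `|x| ≥ 1` (also when `δ = 0`). -/
def ballPower (n : ℕ) (δ : ℂ) (x : EuclideanSpace ℝ (Fin n)) : ℂ :=
  if ‖x‖ < 1 then ((1 - ‖x‖ ^ 2 : ℝ) : ℂ) ^ δ else 0

end BochnerRiesz

end

/-! The function is cut dyadically into pieces living where u = 1-|x|² is comparable to ε = 2^{-k}.
Such a piece has size about ε^σ on a shell of volume O(ε), hence L^q norm O(ε^{σ+1/q})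
(`eLpNorm_annulusFun_le`). Write it as u^δ ψ(u/ε): then I-Δ produces ε^{-2} times a piece of the
same form, whose new profile is polynomial in δ and ε (`schwartzBessel_two_annulusFun`,
`ProfileFamily`). So for even integers s, applying (I-Δ)^{s/2} costs ε^{-s} and a polynomial in |δ|,
which e^{|τ|} absorbs.

Other values of s come from an interpolation inequality valid for every finite q ≥ 1
(`eLpNorm_schwartzBessel_le`). For 0 < a < 1, λ^a is a multiple of λ ∫ t^{-a} e^{-tλ} dt. Times t ≤
T are charged to (I-Δ)f; times t > T, after an integration by parts that removes the factor λ, are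
charged to f. Heat operators are averages of translates, so they do not increase L^q norms. The
choice T = ε² makes both contributions the same power of ε.

The image of the k-th piece under (I-Δ)^{s/2} therefore has L^q norm O(e^{|τ|} 2^{-k(σ+1/q-s)}),
uniformly for σ in a bounded interval, and the series is geometric when s < σ+1/q. Continuity of
(I-Δ)^{s/2} on tempered distributions identifies its sum (`exists_isBesselImage_of_hasSum`). -/

namespace BochnerRiesz

open FourierTransform

/-! ### Averages of translates as L^q-bounded Fourier multipliers -/

section Average

variable {E : Type*} [NormedAddCommGroup E] [InnerProductSpace ℝ E] [FiniteDimensional ℝ E]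
  [MeasurableSpace E] [BorelSpace E] {Ω : Type*} [MeasurableSpace Ω]

/-- Averages of translates do not increase the `L^q` norm, up to the total mass. -/
theorem eLpNorm_average_translates_le (P : Measure Ω) [IsFiniteMeasure P] {Y : Ω → E}
    (hY : Measurable Y) {q : ℝ≥0∞} (hq1 : 1 ≤ q) (hq : q ≠ ∞) {f : E → ℂ} (hf : Continuous f) :
    eLpNorm (fun x ↦ ∫ ω, f (x - Y ω) ∂P) q volume ≤ P Set.univ * eLpNorm f q volume := by
  have hq0 : q ≠ 0 := (zero_lt_one.trans_le hq1).ne'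
  set p := q.toReal with hp
  have hp1 : 1 ≤ p := by
    have := ENNReal.toReal_mono hq hq1
    simpa using this
  have hp0 : 0 < p := by linarith
  have hmeas : Measurable fun z : E × Ω ↦ ‖f (z.1 - Y z.2)‖ₑ ^ p := by
    have : Measurable fun z : E × Ω ↦ f (z.1 - Y z.2) :=
      hf.measurable.comp (measurable_fst.sub (hY.comp measurable_snd))
    exact this.enorm.pow_const _
  -- Hölder against the constant 1. Since P need not have mass one, a power p-1 of its mass appears;
  -- integrating in x adds one more power, and the p-th root leaves the mass itself.
  have hpt (x : E) : ‖∫ ω, f (x - Y ω) ∂P‖ₑ ^ p ≤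
      P Set.univ ^ (p - 1) * ∫⁻ ω, ‖f (x - Y ω)‖ₑ ^ p ∂P := by
    have hm : AEStronglyMeasurable (fun ω ↦ f (x - Y ω)) P :=
      (hf.measurable.comp (measurable_const.sub hY)).aestronglyMeasurable
    have h1 := eLpNorm_le_eLpNorm_mul_rpow_measure_univ hq1 hm
    rw [eLpNorm_one_eq_lintegral_enorm, eLpNorm_eq_lintegral_rpow_enorm_toReal hq0 hq] at h1
    calc _ ≤ (∫⁻ ω, ‖f (x - Y ω)‖ₑ ∂P) ^ p := by
          gcongr; exact enorm_integral_le_lintegral_enorm _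
      _ ≤ _ := ENNReal.rpow_le_rpow h1 hp0.le
      _ = _ := by
          rw [ENNReal.mul_rpow_of_nonneg _ _ hp0.le, ← ENNReal.rpow_mul, ← ENNReal.rpow_mul,
            ← hp, one_div_mul_cancel hp0.ne', ENNReal.rpow_one, mul_comm]
          congr 2
          simp; field_simp
  rw [eLpNorm_eq_lintegral_rpow_enorm_toReal hq0 hq, eLpNorm_eq_lintegral_rpow_enorm_toReal hq0 hq,
    ← hp]
  have hint : ∫⁻ x, ‖∫ ω, f (x - Y ω) ∂P‖ₑ ^ p ≤ P Set.univ ^ p * ∫⁻ x, ‖f x‖ₑ ^ p := by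
    calc _ ≤ ∫⁻ x, P Set.univ ^ (p - 1) * ∫⁻ ω, ‖f (x - Y ω)‖ₑ ^ p ∂P := lintegral_mono hpt
      _ = P Set.univ ^ (p - 1) * ∫⁻ x, ∫⁻ ω, ‖f (x - Y ω)‖ₑ ^ p ∂P := by
          rw [lintegral_const_mul]
          exact hmeas.lintegral_prod_right'
      _ = P Set.univ ^ (p - 1) * ∫⁻ ω, ∫⁻ x, ‖f (x - Y ω)‖ₑ ^ p ∂volume ∂P := by
          rw [lintegral_lintegral_swap hmeas.aemeasurable]
      _ = P Set.univ ^ (p - 1) * ∫⁻ ω, (∫⁻ x, ‖f x‖ₑ ^ p) ∂P := by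
          congr 2 with ω
          exact lintegral_sub_right_eq_self (fun x ↦ ‖f x‖ₑ ^ p) (Y ω)
      _ = P Set.univ ^ p * ∫⁻ x, ‖f x‖ₑ ^ p := by
          rw [lintegral_const, mul_comm (∫⁻ x, ‖f x‖ₑ ^ p), ← mul_assoc]
          congr 1
          conv_lhs => rw [← ENNReal.rpow_one (P Set.univ), ← ENNReal.rpow_mul]
          rw [← ENNReal.rpow_add_of_nonneg _ _ (by linarith) zero_le_one]
          simp
  calc _ ≤ (P Set.univ ^ p * ∫⁻ x, ‖f x‖ₑ ^ p) ^ (1 / p) := by gcongr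
    _ = _ := by
      rw [ENNReal.mul_rpow_of_nonneg _ _ (by positivity), ← ENNReal.rpow_mul,
        mul_one_div_cancel hp0.ne', ENNReal.rpow_one]

/-- The Fourier representation of an average of translates. -/
theorem average_translates_eq_integral_fourier (P : Measure Ω) [IsFiniteMeasure P] {Y : Ω → E}
    (hY : Measurable Y) (f : 𝓢(E, ℂ)) (x : E) :
    Integrable (fun ξ ↦ 𝐞 (inner ℝ ξ x) • ((∫ ω, (𝐞 (-inner ℝ (Y ω) ξ) : ℂ) ∂P) * 𝓕 f ξ)) ∧
    ∫ ω, f (x - Y ω) ∂P =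
      ∫ ξ, 𝐞 (inner ℝ ξ x) • ((∫ ω, (𝐞 (-inner ℝ (Y ω) ξ) : ℂ) ∂P) * 𝓕 f ξ) := by
  have hint : Integrable (Function.uncurry fun (ω : Ω) (ξ : E) ↦
      𝐞 (inner ℝ ξ x) • ((𝐞 (-inner ℝ (Y ω) ξ) : ℂ) * 𝓕 f ξ)) (P.prod volume) := by
    have h0 : Integrable (fun z : Ω × E ↦ (1 : ℂ) * 𝓕 f z.2) (P.prod volume) :=
      (integrable_const (1 : ℂ)).mul_prod (𝓕 f).integrable
    refine h0.mono ?_ ?_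
    · have : Measurable fun z : Ω × E ↦
          𝐞 (inner ℝ z.2 x) • ((𝐞 (-inner ℝ (Y z.1) z.2) : ℂ) * 𝓕 f z.2) := by
        simp only [Circle.smul_def, Real.fourierChar_apply, smul_eq_mul]
        have := (𝓕 f).continuous.measurable
        have h1 : Measurable fun z : Ω × E ↦ inner ℝ (Y z.1) z.2 :=
          (hY.comp measurable_fst).inner measurable_snd
        have h2 : Measurable fun z : Ω × E ↦ inner ℝ z.2 x := measurable_snd.inner measurable_const
        fun_prop
      exact this.aestronglyMeasurable
    · refine Filter.Eventually.of_forall fun z ↦ ?_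
      simp only [Function.uncurry, Circle.smul_def, smul_eq_mul, norm_mul, Circle.norm_coe, one_mul,
        le_refl]
  have hinner (ξ : E) : ∫ ω, 𝐞 (inner ℝ ξ x) • ((𝐞 (-inner ℝ (Y ω) ξ) : ℂ) * 𝓕 f ξ) ∂P =
      𝐞 (inner ℝ ξ x) • ((∫ ω, (𝐞 (-inner ℝ (Y ω) ξ) : ℂ) ∂P) * 𝓕 f ξ) := by
    simp only [Circle.smul_def]
    rw [integral_smul, integral_mul_const]
  have hf (y : E) : f y = ∫ ξ, 𝐞 (inner ℝ ξ y) • 𝓕 f ξ := by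
    have h : 𝓕⁻ (𝓕 f) = f := FourierTransform.fourierInv_fourier_eq f
    rw [← Real.fourierInv_eq, ← SchwartzMap.fourierInv_coe, h]
  constructor
  · have := hint.integral_prod_right
    simpa only [Function.uncurry, hinner] using this
  · calc _ = ∫ ω, (∫ ξ, 𝐞 (inner ℝ ξ x) • ((𝐞 (-inner ℝ (Y ω) ξ) : ℂ) * 𝓕 f ξ)) ∂P := by
          congr 1 with ω
          rw [hf]
          congr 1 with ξ
          simp only [Circle.smul_def, smul_eq_mul]
          rw [← mul_assoc, ← Circle.coe_mul, ← AddChar.map_add_eq_mul, inner_sub_right,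
            real_inner_comm (Y ω) ξ, sub_eq_add_neg]
      _ = _ := by
          rw [integral_integral_swap hint]
          simp only [hinner]

end Average

/-! ### Gaussian averages and superpositions of heat operators -/

section Heat

variable {E : Type*} [NormedAddCommGroup E] [InnerProductSpace ℝ E] [FiniteDimensional ℝ E]
  [MeasurableSpace E] [BorelSpace E]

variable (E) in
/-- The probability measure `e^{-π|z|²} dz`. -/
noncomputable def gaussMeasure : Measure E :=
  volume.withDensity fun z ↦ ENNReal.ofReal (Real.exp (-Real.pi * ‖z‖ ^ 2))

theorem integral_gaussMeasure (f : E → ℂ) :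
    ∫ z, f z ∂gaussMeasure E = ∫ z, (Real.exp (-Real.pi * ‖z‖ ^ 2) : ℂ) * f z := by
  rw [gaussMeasure, integral_withDensity_eq_integral_toReal_smul (by fun_prop) (by simp)]
  congr 1 with z
  rw [ENNReal.toReal_ofReal (Real.exp_pos _).le, Complex.real_smul]

instance : IsProbabilityMeasure (gaussMeasure E) := by
  constructor
  have h := GaussianFourier.integral_rexp_neg_mul_sq_norm (V := E) Real.pi_pos
  rw [div_self Real.pi_ne_zero, Real.one_rpow] at h
  have hi : Integrable (fun z : E ↦ Real.exp (-Real.pi * ‖z‖ ^ 2)) := by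
    by_contra hc
    rw [integral_undef hc] at h
    norm_num at h
  rw [gaussMeasure, withDensity_apply _ MeasurableSet.univ, Measure.restrict_univ,
    ← ofReal_integral_eq_lintegral_ofReal hi (.of_forall fun _ ↦ (Real.exp_pos _).le), h,
    ENNReal.ofReal_one]

/-- The Gaussian e^{-π|z|²} is its own Fourier transform; here it is evaluated at rξ. -/
theorem integral_fourierChar_gaussMeasure (r : ℝ) (ξ : E) :
    ∫ z, (𝐞 (-inner ℝ (r • z) ξ) : ℂ) ∂gaussMeasure E =
      (Real.exp (-Real.pi * r ^ 2 * ‖ξ‖ ^ 2) : ℂ) := by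
  have h := fourier_gaussian_innerProductSpace (V := E) (b := Real.pi)
    (by simpa using Real.pi_pos) (r • ξ)
  rw [Real.fourier_eq, div_self (by exact_mod_cast Real.pi_ne_zero), Complex.one_cpow, one_mul,
    norm_smul] at h
  rw [integral_gaussMeasure]
  convert! h using 1
  · congr 1 with z
    rw [Circle.smul_def, smul_eq_mul, mul_comm, real_inner_smul_left, real_inner_smul_right]
    push_cast
    rfl
  · push_cast
    congr 1
    have : ((|r| : ℝ) : ℂ) ^ 2 = (r : ℂ) ^ 2 := by
      rw [← Complex.ofReal_pow, sq_abs, Complex.ofReal_pow]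
    rw [Real.norm_eq_abs, mul_pow, this]
    have : (Real.pi : ℂ) ≠ 0 := by exact_mod_cast Real.pi_ne_zero
    field_simp

/-- A superposition of heat operators is given by its Laplace-transform symbol and is bounded on
`L^q` by the total mass of the mixing measure. -/
theorem exists_heat_superposition (μ : Measure ℝ) [IsFiniteMeasure μ] (hμ : ∀ᵐ t ∂μ, 0 ≤ t)
    {q : ℝ≥0∞} (hq1 : 1 ≤ q) (hq : q ≠ ∞) (f : 𝓢(E, ℂ)) :
    ∃ g : E → ℂ, AEStronglyMeasurable g volume ∧
      eLpNorm g q volume ≤ μ Set.univ * eLpNorm f q volume ∧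
      ∀ x, Integrable (fun ξ ↦ 𝐞 (inner ℝ ξ x) •
          ((∫ t, Real.exp (-(4 * Real.pi ^ 2 * t * ‖ξ‖ ^ 2)) ∂μ : ℝ) * 𝓕 f ξ)) ∧
        g x = ∫ ξ, 𝐞 (inner ℝ ξ x) •
          ((∫ t, Real.exp (-(4 * Real.pi ^ 2 * t * ‖ξ‖ ^ 2)) ∂μ : ℝ) * 𝓕 f ξ) := by
  -- With r = 2√(πt) one has πr² = 4π²t, the exponent of the heat symbol at time t.
  set Y : ℝ × E → E := fun w ↦ (2 * Real.sqrt (Real.pi * w.1)) • w.2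
  have hY : Measurable Y := by fun_prop
  set P := μ.prod (gaussMeasure E)
  have hP : P Set.univ = μ Set.univ := by
    rw [← Set.univ_prod_univ, Measure.prod_prod, measure_univ (μ := gaussMeasure E), mul_one]
  have hsymb (ξ : E) : ∫ ω, (𝐞 (-inner ℝ (Y ω) ξ) : ℂ) ∂P =
      ((∫ t, Real.exp (-(4 * Real.pi ^ 2 * t * ‖ξ‖ ^ 2)) ∂μ : ℝ) : ℂ) := by
    have hi : Integrable (fun ω ↦ (𝐞 (-inner ℝ (Y ω) ξ) : ℂ)) P := by
      refine (integrable_const (1 : ℂ)).mono ?_ (.of_forall fun ω ↦ by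
        rw [Circle.norm_coe, norm_one])
      have h1 : Measurable fun ω : ℝ × E ↦ inner ℝ (Y ω) ξ := hY.inner measurable_const
      simp only [Real.fourierChar_apply]
      have : Measurable fun ω : ℝ × E ↦
          Complex.exp (((2 * Real.pi * -inner ℝ (Y ω) ξ : ℝ) : ℂ) * Complex.I) := by fun_prop
      exact this.aestronglyMeasurable
    rw [integral_prod _ hi, ← integral_complex_ofReal]
    refine integral_congr_ae ?_
    filter_upwards [hμ] with t ht
    simp only [Y]
    rw [integral_fourierChar_gaussMeasure, mul_pow, Real.sq_sqrt (by positivity)]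
    congr 2
    ring
  refine ⟨fun x ↦ ∫ ω, f (x - Y ω) ∂P, ?_, ?_, fun x ↦ ?_⟩
  · have : StronglyMeasurable fun z : E × (ℝ × E) ↦ f (z.1 - Y z.2) :=
      (f.continuous.measurable.comp
        (measurable_fst.sub (hY.comp measurable_snd))).stronglyMeasurable
    exact this.integral_prod_right'.aestronglyMeasurable
  · rw [← hP]
    exact eLpNorm_average_translates_le P hY hq1 hq f.continuous
  · simpa only [hsymb] using average_translates_eq_integral_fourier P hY f x

end Heat

/-! ### Laplace integral for the fractional power of a positive number -/

section Scalar

open Real Set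

theorem integrableOn_Ioi_rpow_mul_exp {T p l : ℝ} (hT : 0 < T) (hl : 0 < l) (hp : p ≤ 0) :
    IntegrableOn (fun t ↦ t ^ p * exp (-(t * l))) (Ioi T) := by
  have h0 : IntegrableOn (fun t ↦ T ^ p * exp (-l * t)) (Ioi T) :=
    (exp_neg_integrableOn_Ioi T hl).const_mul _
  refine h0.mono' ?_ ?_
  · exact Measurable.aestronglyMeasurable (by fun_prop)
  · filter_upwards [ae_restrict_mem measurableSet_Ioi] with t ht
    have ht' : T < t := ht
    have ht0 : 0 < t := hT.trans ht'
    rw [norm_of_nonneg (by positivity), show -(t * l) = -l * t by ring]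
    exact mul_le_mul_of_nonneg_right (rpow_le_rpow_of_nonpos hT ht'.le hp) (exp_pos _).le

/-- Removes the factor l for large times, so that there the heat operators act on f and not on
(I-Δ)f. The price is a boundary term at T. -/
theorem integral_Ioi_rpow_mul_exp_by_parts {a T l : ℝ} (ha : 0 < a) (hT : 0 < T) (hl : 0 < l) :
    l * ∫ t in Ioi T, t ^ (-a) * exp (-(t * l)) =
      T ^ (-a) * exp (-(T * l)) - a * ∫ t in Ioi T, t ^ (-a - 1) * exp (-(t * l)) := by
  have i1 := integrableOn_Ioi_rpow_mul_exp hT hl (show -a ≤ 0 by linarith)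
  have i2 := integrableOn_Ioi_rpow_mul_exp hT hl (show -a - 1 ≤ 0 by linarith)
  have hd : ∀ t ∈ Ici T, HasDerivAt (fun t ↦ t ^ (-a) * exp (-(t * l)))
      (-a * (t ^ (-a - 1) * exp (-(t * l))) - l * (t ^ (-a) * exp (-(t * l)))) t := by
    intro t ht
    have ht0 : 0 < t := hT.trans_le ht
    have h1 := Real.hasDerivAt_rpow_const (p := -a) (Or.inl ht0.ne')
    have h2 : HasDerivAt (fun t ↦ exp (-(t * l))) (exp (-(t * l)) * (-(1 * l))) t :=
      (((hasDerivAt_id t).mul_const l).neg).exp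
    convert! h1.mul h2 using 1
    ring
  have hlim : Filter.Tendsto (fun t ↦ t ^ (-a) * exp (-(t * l))) Filter.atTop (nhds 0) := by
    have h1 := tendsto_rpow_neg_atTop ha
    have h2 : Filter.Tendsto (fun t ↦ exp (-(t * l))) Filter.atTop (nhds 0) :=
      tendsto_exp_neg_atTop_nhds_zero.comp (Filter.tendsto_id.atTop_mul_const hl)
    simpa using h1.mul h2
  have := integral_Ioi_of_hasDerivAt_of_tendsto' hd ((i2.const_mul (-a)).sub (i1.const_mul l)) hlim
  rw [integral_sub (i2.const_mul (-a)) (i1.const_mul l), integral_const_mul,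
    integral_const_mul] at this
  linarith

theorem integral_Ioi_zero_rpow_mul_exp {a l : ℝ} (ha1 : a < 1) (hl : 0 < l) :
    ∫ t in Ioi 0, t ^ (-a) * exp (-(t * l)) = (1 / l) ^ (1 - a) * Gamma (1 - a) := by
  rw [← integral_rpow_mul_exp_neg_mul_Ioi (a := 1 - a) (by linarith) hl]
  congr 1 with t
  rw [mul_comm l t, sub_sub, add_comm a 1, ← sub_sub, sub_self, zero_sub]

theorem integrableOn_Ioi_zero_rpow_mul_exp {a l : ℝ} (ha1 : a < 1) (hl : 0 < l) :
    IntegrableOn (fun t ↦ t ^ (-a) * exp (-(t * l))) (Ioi 0) := by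
  have h := integral_Ioi_zero_rpow_mul_exp ha1 hl
  -- A non-integrable function would have integral 0, against the positive Gamma value.
  by_contra hc
  rw [integral_undef hc] at h
  have : 0 < (1 / l) ^ (1 - a) * Gamma (1 - a) :=
    mul_pos (by positivity) (Gamma_pos_of_pos (by linarith))
  linarith

/-- A formula for `λ^a` splitting small and large times in the heat superposition. -/
theorem gamma_mul_rpow_eq {a T l : ℝ} (ha : 0 < a) (ha1 : a < 1) (hT : 0 < T) (hl : 0 < l) :
    Gamma (1 - a) * l ^ a = l * (∫ t in Ioc 0 T, t ^ (-a) * exp (-(t * l))) +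
      T ^ (-a) * exp (-(T * l)) - a * ∫ t in Ioi T, t ^ (-a - 1) * exp (-(t * l)) := by
  have h := integral_Ioi_zero_rpow_mul_exp ha1 hl
  have hi := integrableOn_Ioi_zero_rpow_mul_exp ha1 hl
  rw [← Ioc_union_Ioi_eq_Ioi hT.le, setIntegral_union (Ioc_disjoint_Ioi le_rfl) measurableSet_Ioi
    (hi.mono_set Ioc_subset_Ioi_self) (hi.mono_set (Ioi_subset_Ioi hT.le))] at h
  have hb := integral_Ioi_rpow_mul_exp_by_parts ha hT hl
  have : l * ((1 / l) ^ (1 - a) * Gamma (1 - a)) = Gamma (1 - a) * l ^ a := by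
    rw [one_div, inv_rpow hl.le, ← rpow_neg hl.le]
    have : l * l ^ (-(1 - a)) = l ^ a := by
      nth_rw 1 [← rpow_one l]
      rw [← rpow_add hl]; congr 1; ring
    rw [← mul_assoc, this, mul_comm]
  rw [← this, ← h, mul_add, hb]
  ring

end Scalar

/-! ### Interpolating fractional powers of I-Δ in L^q -/

section Interpolation

open Real Set

/-- The factor e^{-t} of e^{-t(1+l)} goes into the measure, which leaves a pure heat symbol once l =
4π²|ξ|². Since e^{-t} ≤ 1, the mass does not grow. -/
theorem exists_weighted_measure {S : Set ℝ} (hS : MeasurableSet S) (hS0 : S ⊆ Ioi 0) {ρ : ℝ → ℝ}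
    (hρm : Measurable ρ) (hρ : ∀ t ∈ S, 0 ≤ ρ t) (hi : IntegrableOn ρ S) :
    ∃ μ : Measure ℝ, IsFiniteMeasure μ ∧ (∀ᵐ t ∂μ, 0 ≤ t) ∧
      μ univ ≤ ENNReal.ofReal (∫ t in S, ρ t) ∧
      ∀ l : ℝ, ∫ t, exp (-(t * l)) ∂μ = ∫ t in S, ρ t * exp (-(t * (1 + l))) := by
  set μ := (volume.restrict S).withDensity fun t ↦ ENNReal.ofReal (ρ t * exp (-t)) with hμ
  have hm : Measurable fun t ↦ ENNReal.ofReal (ρ t * exp (-t)) := by fun_prop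
  have hmass : μ univ ≤ ENNReal.ofReal (∫ t in S, ρ t) := by
    rw [hμ, withDensity_apply _ MeasurableSet.univ, Measure.restrict_univ,
      ofReal_integral_eq_lintegral_ofReal hi ((ae_restrict_iff' hS).2 (.of_forall hρ))]
    refine setLIntegral_mono' hS fun t ht ↦ ENNReal.ofReal_le_ofReal ?_
    have ht0 : 0 < t := hS0 ht
    exact mul_le_of_le_one_right (hρ t ht) (exp_le_one_iff.2 (by linarith))
  refine ⟨μ, ⟨hmass.trans_lt ENNReal.ofReal_lt_top⟩, ?_, hmass, fun l ↦ ?_⟩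
  · refine (withDensity_absolutelyContinuous _ _).ae_le ?_
    filter_upwards [ae_restrict_mem hS] with t ht
    exact (hS0 ht).le
  · rw [hμ, integral_withDensity_eq_integral_toReal_smul hm (by simp)]
    refine setIntegral_congr_fun hS fun t ht ↦ ?_
    simp only [smul_eq_mul]
    rw [ENNReal.toReal_ofReal (mul_nonneg (hρ t ht) (exp_pos _).le), mul_assoc, ← exp_add]
    congr 2
    ring

variable {n : ℕ}

theorem besselSymbol_two (ξ : EuclideanSpace ℝ (Fin n)) :
    besselSymbol n 2 ξ = 1 + 4 * π ^ 2 * ‖ξ‖ ^ 2 := by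
  simp [besselSymbol]

theorem besselSymbol_add (s t : ℝ) (ξ : EuclideanSpace ℝ (Fin n)) :
    besselSymbol n (s + t) ξ = besselSymbol n s ξ * besselSymbol n t ξ := by
  rw [besselSymbol, besselSymbol, besselSymbol, ← rpow_add (by positivity), add_div]

/-- The operator `(I - Δ)^{s/2}` on Schwartz functions. -/
noncomputable def schwartzBessel (n : ℕ) (s : ℝ) :
    𝓢(EuclideanSpace ℝ (Fin n), ℂ) →L[ℂ] 𝓢(EuclideanSpace ℝ (Fin n), ℂ) :=
  SchwartzMap.fourierMultiplierCLM ℂ (fun ξ ↦ (besselSymbol n s ξ : ℂ))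

theorem schwartzBessel_add (s t : ℝ) (f : 𝓢(EuclideanSpace ℝ (Fin n), ℂ)) :
    schwartzBessel n (s + t) f = schwartzBessel n s (schwartzBessel n t f) := by
  rw [schwartzBessel, schwartzBessel, schwartzBessel,
    SchwartzMap.fourierMultiplierCLM_fourierMultiplierCLM_apply
      (besselSymbol_hasTemperateGrowth n s) (besselSymbol_hasTemperateGrowth n t)]
  congr 2
  funext ξ
  simp [besselSymbol_add]

theorem schwartzBessel_zero (f : 𝓢(EuclideanSpace ℝ (Fin n), ℂ)) :
    schwartzBessel n 0 f = f := by
  simp [schwartzBessel, besselSymbol]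

theorem fourier_schwartzBessel (s : ℝ) (f : 𝓢(EuclideanSpace ℝ (Fin n), ℂ))
    (ξ : EuclideanSpace ℝ (Fin n)) :
    𝓕 (schwartzBessel n s f) ξ = besselSymbol n s ξ * 𝓕 f ξ := by
  have h : 𝓕 (schwartzBessel n s f) =
      SchwartzMap.smulLeftCLM ℂ (fun ξ ↦ (besselSymbol n s ξ : ℂ)) (𝓕 f) := by
    rw [schwartzBessel, SchwartzMap.fourierMultiplierCLM_apply]
    exact FourierTransform.fourier_fourierInv_eq _
  rw [h, SchwartzMap.smulLeftCLM_apply_apply (besselSymbol_hasTemperateGrowth n s), smul_eq_mul]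

theorem schwartzBessel_apply (s : ℝ) (f : 𝓢(EuclideanSpace ℝ (Fin n), ℂ))
    (x : EuclideanSpace ℝ (Fin n)) :
    schwartzBessel n s f x = ∫ ξ, 𝐞 (inner ℝ ξ x) • ((besselSymbol n s ξ : ℂ) * 𝓕 f ξ) := by
  have h : 𝓕⁻ (𝓕 (schwartzBessel n s f)) = schwartzBessel n s f :=
    FourierTransform.fourierInv_fourier_eq _
  rw [← h, SchwartzMap.fourierInv_coe, Real.fourierInv_eq]
  simp only [fourier_schwartzBessel]

/-- Interpolation of fractional powers of `I - Δ` between `I` and `I - Δ`, in any `L^q`. -/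
theorem eLpNorm_schwartzBessel_le {a T : ℝ} (ha : 0 < a) (ha1 : a < 1) (hT : 0 < T)
    {q : ℝ≥0∞} (hq1 : 1 ≤ q) (hq : q ≠ ∞) (f : 𝓢(EuclideanSpace ℝ (Fin n), ℂ)) :
    eLpNorm (schwartzBessel n (2 * a) f) q volume ≤ ENNReal.ofReal (Gamma (1 - a))⁻¹ *
      (ENNReal.ofReal (T ^ (1 - a) / (1 - a)) * eLpNorm (schwartzBessel n 2 f) q volume +
        2 * (ENNReal.ofReal (T ^ (-a)) * eLpNorm f q volume)) := by
  have hΓ : 0 < Gamma (1 - a) := Gamma_pos_of_pos (by linarith)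
  -- One measure for each term of `gamma_mul_rpow_eq`: μ₁ for small times, acting on (I-Δ)f; μ₂, a
  -- point mass at T, for the boundary term; μ₃ for the tail. The last two act on f with mass at
  -- most T^{-a} each, whence the factor 2.
  obtain ⟨μ₁, _, hμ₁, hm₁, hs₁⟩ := exists_weighted_measure (S := Ioc 0 T) measurableSet_Ioc
    Ioc_subset_Ioi_self (ρ := fun t ↦ t ^ (-a)) (by fun_prop)
    (fun t ht ↦ rpow_nonneg ht.1.le _)
    ((intervalIntegrable_iff_integrableOn_Ioc_of_le hT.le).1
      (intervalIntegral.intervalIntegrable_rpow' (by linarith)))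
  obtain ⟨μ₃, _, hμ₃, hm₃, hs₃⟩ := exists_weighted_measure (S := Ioi T) measurableSet_Ioi
    (Ioi_subset_Ioi hT.le) (ρ := fun t ↦ a * t ^ (-a - 1)) (by fun_prop)
    (fun t ht ↦ mul_nonneg ha.le (rpow_nonneg (hT.le.trans ht.le) _))
    ((integrableOn_Ioi_rpow_of_lt (by linarith) hT).const_mul a)
  rw [← intervalIntegral.integral_of_le hT.le, integral_rpow (Or.inl (by linarith)),
    zero_rpow (by linarith), sub_zero, neg_add_eq_sub] at hm₁
  rw [integral_const_mul, integral_Ioi_rpow_of_lt (by linarith) hT, sub_add_cancel,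
    show a * (-T ^ (-a) / -a) = T ^ (-a) by field_simp] at hm₃
  set μ₂ : Measure ℝ := ENNReal.ofReal (T ^ (-a) * exp (-T)) • Measure.dirac T with hμ₂d
  have : IsFiniteMeasure μ₂ := Measure.smul_finite _ ENNReal.ofReal_ne_top
  have hμ₂ : ∀ᵐ t ∂μ₂, 0 ≤ t := by
    refine Measure.ae_smul_measure ?_ _
    rw [ae_dirac_eq]
    exact hT.le
  have hm₂ : μ₂ univ ≤ ENNReal.ofReal (T ^ (-a)) := by
    rw [hμ₂d, Measure.smul_apply, measure_univ, smul_eq_mul, mul_one]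
    exact ENNReal.ofReal_le_ofReal
      (mul_le_of_le_one_right (by positivity) (exp_le_one_iff.2 (by linarith)))
  have hs₂ (l : ℝ) : ∫ t, exp (-(t * l)) ∂μ₂ = T ^ (-a) * exp (-(T * (1 + l))) := by
    rw [hμ₂d, integral_smul_measure, integral_dirac, ENNReal.toReal_ofReal (by positivity),
      smul_eq_mul, mul_assoc, ← exp_add]
    congr 2
    ring
  obtain ⟨g₁, hg₁m, hg₁, hg₁x⟩ := exists_heat_superposition μ₁ hμ₁ hq1 hq (schwartzBessel n 2 f)
  obtain ⟨g₂, hg₂m, hg₂, hg₂x⟩ := exists_heat_superposition μ₂ hμ₂ hq1 hq f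
  obtain ⟨g₃, hg₃m, hg₃, hg₃x⟩ := exists_heat_superposition μ₃ hμ₃ hq1 hq f
  have e (t : ℝ) (ξ : EuclideanSpace ℝ (Fin n)) :
      4 * π ^ 2 * t * ‖ξ‖ ^ 2 = t * (4 * π ^ 2 * ‖ξ‖ ^ 2) := by ring
  simp only [e, hs₁, hs₂, hs₃, fourier_schwartzBessel, besselSymbol_two] at hg₁x hg₂x hg₃x
  have hrep : (schwartzBessel n (2 * a) f : EuclideanSpace ℝ (Fin n) → ℂ) =
      (((Gamma (1 - a))⁻¹ : ℝ) : ℂ) • (g₁ + g₂ - g₃) := by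
    funext x
    simp only [Pi.smul_apply, Pi.sub_apply, Pi.add_apply]
    rw [(hg₁x x).2, (hg₂x x).2, (hg₃x x).2, ← integral_add' (hg₁x x).1 (hg₂x x).1,
      ← integral_sub' ((hg₁x x).1.add (hg₂x x).1) (hg₃x x).1, ← integral_smul, schwartzBessel_apply]
    congr 1 with ξ
    have hl : 0 < 1 + 4 * π ^ 2 * ‖ξ‖ ^ 2 := by positivity
    have key := gamma_mul_rpow_eq ha ha1 hT hl
    have hsym : besselSymbol n (2 * a) ξ = (Gamma (1 - a))⁻¹ *
        ((1 + 4 * π ^ 2 * ‖ξ‖ ^ 2) *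
          (∫ t in Ioc 0 T, t ^ (-a) * exp (-(t * (1 + 4 * π ^ 2 * ‖ξ‖ ^ 2)))) +
        T ^ (-a) * exp (-(T * (1 + 4 * π ^ 2 * ‖ξ‖ ^ 2))) -
        ∫ t in Ioi T, a * t ^ (-a - 1) * exp (-(t * (1 + 4 * π ^ 2 * ‖ξ‖ ^ 2)))) := by
      simp_rw [mul_assoc a]
      rw [integral_const_mul, ← key, inv_mul_cancel_left₀ hΓ.ne', besselSymbol,
        mul_div_cancel_left₀ a two_ne_zero]
    rw [hsym]
    simp only [Circle.smul_def, smul_eq_mul, Pi.sub_apply, Pi.add_apply]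
    push_cast
    ring
  rw [hrep, eLpNorm_const_smul]
  have hn : ‖(((Gamma (1 - a))⁻¹ : ℝ) : ℂ)‖ₑ = ENNReal.ofReal (Gamma (1 - a))⁻¹ := by
    rw [← ofReal_norm, Complex.norm_real, norm_of_nonneg (inv_nonneg.2 hΓ.le)]
  rw [hn]
  gcongr
  calc eLpNorm (g₁ + g₂ - g₃) q volume
      ≤ eLpNorm g₁ q volume + eLpNorm g₂ q volume + eLpNorm g₃ q volume :=
        (eLpNorm_sub_le (hg₁m.add hg₂m) hg₃m hq1).trans
          (by gcongr; exact eLpNorm_add_le hg₁m hg₂m hq1)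
    _ ≤ _ := by
        rw [two_mul, ← add_assoc]
        refine add_le_add (add_le_add ?_ ?_) ?_
        · exact hg₁.trans (by gcongr)
        · exact hg₂.trans (by gcongr)
        · exact hg₃.trans (by gcongr)

end Interpolation

/-! ### Profiles and their polynomial dependence on δ and ε -/

section Profile

open Set
open scoped ContDiff

/-- A smooth function on `ℝ` vanishing outside `[1/2, 2]`. -/
structure IsProfile (ψ : ℝ → ℂ) : Prop where
  contDiff : ContDiff ℝ ∞ ψ
  eq_zero : ∀ v, v ∉ Icc (1 / 2 : ℝ) 2 → ψ v = 0

namespace IsProfile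

variable {ψ φ : ℝ → ℂ}

theorem add (hψ : IsProfile ψ) (hφ : IsProfile φ) : IsProfile fun v ↦ ψ v + φ v where
  contDiff := hψ.contDiff.add hφ.contDiff
  eq_zero v hv := by rw [hψ.eq_zero v hv, hφ.eq_zero v hv, add_zero]

theorem const_mul (c : ℂ) (hψ : IsProfile ψ) : IsProfile fun v ↦ c * ψ v where
  contDiff := contDiff_const.mul hψ.contDiff
  eq_zero v hv := by rw [hψ.eq_zero v hv, mul_zero]

theorem id_mul (hψ : IsProfile ψ) : IsProfile fun v ↦ (v : ℂ) * ψ v where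
  contDiff := Complex.ofRealCLM.contDiff.mul hψ.contDiff
  eq_zero v hv := by rw [hψ.eq_zero v hv, mul_zero]

theorem eventually_eq_zero (hψ : IsProfile ψ) {v : ℝ} (hv : v ∉ Icc (1 / 2 : ℝ) 2) :
    ψ =ᶠ[nhds v] 0 := by
  filter_upwards [isClosed_Icc.isOpen_compl.mem_nhds hv] with w hw
  exact hψ.eq_zero w hw

theorem deriv (hψ : IsProfile ψ) : IsProfile (deriv ψ) where
  contDiff := ((contDiff_infty_iff_deriv).1 hψ.contDiff).2
  eq_zero v hv := by
    rw [(hψ.eventually_eq_zero hv).deriv_eq]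
    simp

/-- The support stays away from the singularity at v = 0. -/
theorem inv_mul (hψ : IsProfile ψ) : IsProfile fun v ↦ (v : ℂ)⁻¹ * ψ v where
  contDiff := by
    rw [contDiff_iff_contDiffAt]
    intro v
    by_cases hv : v ∈ Icc (1 / 2 : ℝ) 2
    · have hv0 : (v : ℂ) ≠ 0 := by
        have : (0 : ℝ) < v := by linarith [hv.1]
        exact_mod_cast this.ne'
      exact (Complex.ofRealCLM.contDiff.contDiffAt.inv hv0).mul hψ.contDiff.contDiffAt
    · refine (contDiffAt_const (c := (0 : ℂ))).congr_of_eventuallyEq ?_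
      filter_upwards [hψ.eventually_eq_zero hv] with w hw
      rw [hw, Pi.zero_apply, mul_zero]
  eq_zero v hv := by rw [hψ.eq_zero v hv, mul_zero]

theorem exists_bound (hψ : IsProfile ψ) : ∃ C : ℝ, 0 ≤ C ∧ ∀ v, ‖ψ v‖ ≤ C := by
  obtain ⟨C, hC⟩ := isCompact_Icc.exists_bound_of_continuousOn
    (s := Icc (1 / 2 : ℝ) 2) hψ.contDiff.continuous.continuousOn
  refine ⟨max C 0, le_max_right _ _, fun v ↦ ?_⟩
  by_cases hv : v ∈ Icc (1 / 2 : ℝ) 2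
  · exact (hC v hv).trans (le_max_left _ _)
  · rw [hψ.eq_zero v hv, norm_zero]
    exact le_max_right _ _

end IsProfile

/-- The operator `ψ ↦ δ ψ / v + dψ/dv`, which is differentiation conjugated by `v^δ`. -/
noncomputable def powDeriv (δ : ℂ) (ψ : ℝ → ℂ) (v : ℝ) : ℂ := δ * ((v : ℂ)⁻¹ * ψ v) + deriv ψ v

theorem IsProfile.powDeriv {ψ : ℝ → ℂ} (hψ : IsProfile ψ) (δ : ℂ) : IsProfile (powDeriv δ ψ) :=
  (hψ.inv_mul.const_mul δ).add hψ.deriv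

/-- The operator induced by `I - Δ` on profiles, in the variable `v = (1 - |x|²) / ε`. -/
noncomputable def profileOp (n : ℕ) (δ : ℂ) (ε : ℝ) (ψ : ℝ → ℂ) (v : ℝ) : ℂ :=
  ε * (ε * ψ v) + (-4 * powDeriv δ (powDeriv δ ψ) v +
    (ε * (4 * ((v : ℂ) * powDeriv δ (powDeriv δ ψ) v)) + ε * (2 * n * powDeriv δ ψ v)))

theorem IsProfile.profileOp {ψ : ℝ → ℂ} (hψ : IsProfile ψ) (n : ℕ) (δ : ℂ) (ε : ℝ) :
    IsProfile (profileOp n δ ε ψ) :=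
  ((hψ.const_mul _).const_mul _).add ((((hψ.powDeriv δ).powDeriv δ).const_mul _).add
    (((((hψ.powDeriv δ).powDeriv δ).id_mul.const_mul _).const_mul _).add
      (((hψ.powDeriv δ).const_mul _).const_mul _)))

/-- Families of profiles depending polynomially on the parameters `δ` and `ε`. -/
inductive ProfileFamily : (ℂ → ℝ → ℝ → ℂ) → Prop
  | const {ψ : ℝ → ℂ} (hψ : IsProfile ψ) : ProfileFamily fun _ _ ↦ ψ
  | delta {Ψ : ℂ → ℝ → ℝ → ℂ} (hΨ : ProfileFamily Ψ) : ProfileFamily fun δ ε v ↦ δ * Ψ δ ε v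
  | eps {Ψ : ℂ → ℝ → ℝ → ℂ} (hΨ : ProfileFamily Ψ) : ProfileFamily fun δ ε v ↦ ε * Ψ δ ε v
  | add {Ψ Φ : ℂ → ℝ → ℝ → ℂ} (hΨ : ProfileFamily Ψ) (hΦ : ProfileFamily Φ) :
      ProfileFamily fun δ ε v ↦ Ψ δ ε v + Φ δ ε v

namespace ProfileFamily

variable {Ψ : ℂ → ℝ → ℝ → ℂ}

theorem isProfile (hΨ : ProfileFamily Ψ) (δ : ℂ) (ε : ℝ) : IsProfile (Ψ δ ε) := by
  induction hΨ with
  | const hψ => exact hψ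
  | delta _ ih => exact ih.const_mul _
  | eps _ ih => exact ih.const_mul _
  | add _ _ ih₁ ih₂ => exact ih₁.add ih₂

theorem congr {Φ : ℂ → ℝ → ℝ → ℂ} (hΨ : ProfileFamily Ψ) (h : ∀ δ ε v, Φ δ ε v = Ψ δ ε v) :
    ProfileFamily Φ := by
  have : Φ = Ψ := funext₃ h
  rwa [this]

theorem const_mul (hΨ : ProfileFamily Ψ) (c : ℂ) : ProfileFamily fun δ ε v ↦ c * Ψ δ ε v := by
  induction hΨ with
  | const hψ => exact .const (hψ.const_mul c)
  | delta _ ih => simpa only [mul_left_comm c] using ih.delta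
  | eps _ ih => simpa only [mul_left_comm c] using ih.eps
  | add _ _ ih₁ ih₂ => simpa only [mul_add] using ih₁.add ih₂

theorem id_mul (hΨ : ProfileFamily Ψ) : ProfileFamily fun δ ε v ↦ (v : ℂ) * Ψ δ ε v := by
  induction hΨ with
  | const hψ => exact .const hψ.id_mul
  | delta _ ih =>
    refine congr ih.delta fun δ ε v ↦ ?_
    ring
  | eps _ ih =>
    refine congr ih.eps fun δ ε v ↦ ?_
    ring
  | add _ _ ih₁ ih₂ => simpa only [mul_add] using ih₁.add ih₂

/-- The operator is linear in the profile and commutes with scalars, so only a fixed profile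
matters: there it gives δ times one fixed profile plus another. -/
theorem powDeriv (hΨ : ProfileFamily Ψ) : ProfileFamily fun δ ε ↦ powDeriv δ (Ψ δ ε) := by
  induction hΨ with
  | const hψ => exact (ProfileFamily.const hψ.inv_mul).delta.add (.const hψ.deriv)
  | delta h ih =>
    refine congr ih.delta fun δ ε v ↦ ?_
    have := (h.isProfile δ ε).contDiff.differentiable (by simp) v
    simp only [BochnerRiesz.powDeriv]
    rw [deriv_const_mul _ this]
    ring
  | eps h ih =>
    refine congr ih.eps fun δ ε v ↦ ?_
    have := (h.isProfile δ ε).contDiff.differentiable (by simp) v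
    simp only [BochnerRiesz.powDeriv]
    rw [deriv_const_mul _ this]
    ring
  | add h₁ h₂ ih₁ ih₂ =>
    refine congr (ih₁.add ih₂) fun δ ε v ↦ ?_
    have t₁ := (h₁.isProfile δ ε).contDiff.differentiable (by simp) v
    have t₂ := (h₂.isProfile δ ε).contDiff.differentiable (by simp) v
    simp only [BochnerRiesz.powDeriv]
    rw [deriv_fun_add t₁ t₂]
    ring

theorem profileOp (hΨ : ProfileFamily Ψ) (n : ℕ) :
    ProfileFamily fun δ ε ↦ profileOp n δ ε (Ψ δ ε) :=
  hΨ.eps.eps.add ((hΨ.powDeriv.powDeriv.const_mul _).add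
    ((hΨ.powDeriv.powDeriv.id_mul.const_mul _).eps.add (hΨ.powDeriv.const_mul _).eps))

/-- Only multiplication by δ raises the degree N; factors ε are harmless for 0 ≤ ε ≤ 1. This is the
source of the merely polynomial growth in τ. -/
theorem exists_bound (hΨ : ProfileFamily Ψ) : ∃ C : ℝ, 0 ≤ C ∧ ∃ N : ℕ, ∀ δ ε v, 0 ≤ ε → ε ≤ 1 →
    ‖Ψ δ ε v‖ ≤ C * (1 + ‖δ‖) ^ N := by
  induction hΨ with
  | const hψ =>
    obtain ⟨C, hC0, hC⟩ := hψ.exists_bound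
    exact ⟨C, hC0, 0, fun δ ε v _ _ ↦ by simpa using hC v⟩
  | delta _ ih =>
    obtain ⟨C, hC0, N, h⟩ := ih
    refine ⟨C, hC0, N + 1, fun δ ε v h0 h1 ↦ ?_⟩
    rw [norm_mul]
    calc ‖δ‖ * _ ≤ (1 + ‖δ‖) * (C * (1 + ‖δ‖) ^ N) := by
          gcongr
          · linarith
          · exact h δ ε v h0 h1
      _ = _ := by ring
  | eps _ ih =>
    obtain ⟨C, hC0, N, h⟩ := ih
    refine ⟨C, hC0, N, fun δ ε v h0 h1 ↦ ?_⟩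
    rw [norm_mul, Complex.norm_real, Real.norm_of_nonneg h0]
    exact (mul_le_of_le_one_left (norm_nonneg _) h1).trans (h δ ε v h0 h1)
  | add _ _ ih₁ ih₂ =>
    obtain ⟨C, hC0, N, h⟩ := ih₁
    obtain ⟨D, hD0, M, h'⟩ := ih₂
    refine ⟨C + D, by positivity, N + M, fun δ ε v h0 h1 ↦ ?_⟩
    have hδ : 1 ≤ 1 + ‖δ‖ := by linarith [norm_nonneg δ]
    rw [add_mul]
    refine (norm_add_le _ _).trans (add_le_add ((h δ ε v h0 h1).trans ?_)
      ((h' δ ε v h0 h1).trans ?_))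
    · gcongr
      omega
    · gcongr
      omega

end ProfileFamily

end Profile

/-! ### Radial functions of 1-|x|² and the action of I-Δ -/

section Radial

open Set
open scoped ContDiff Laplacian LineDeriv

/-- The function `u ↦ u^δ ψ(u / ε)`. -/
noncomputable def cutPower (δ : ℂ) (ε : ℝ) (ψ : ℝ → ℂ) (u : ℝ) : ℂ := (u : ℂ) ^ δ * ψ (u / ε)

variable {ψ : ℝ → ℂ} {δ : ℂ} {ε : ℝ}

theorem IsProfile.eventually_cutPower_eq_zero (hψ : IsProfile ψ) {u : ℝ}
    (hu : u / ε ∉ Icc (1 / 2 : ℝ) 2) : cutPower δ ε ψ =ᶠ[nhds u] 0 := by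
  have hc : ContinuousAt (fun u ↦ u / ε) u := by fun_prop
  filter_upwards [hc.eventually (hψ.eventually_eq_zero hu)] with w hw
  simp only [cutPower, hw, Pi.zero_apply, mul_zero]

theorem pos_of_div_mem_Icc (hε : 0 < ε) {u : ℝ} (hu : u / ε ∈ Icc (1 / 2 : ℝ) 2) : 0 < u := by
  have h1 : 0 < u / ε := by linarith [hu.1]
  exact (div_pos_iff_of_pos_right hε).1 h1

/-- Where the profile can be nonzero u is positive, so the principal branch of u^δ is
differentiable; elsewhere both functions vanish near u. -/
theorem hasDerivAt_cutPower (hψ : IsProfile ψ) (hε : 0 < ε) (u : ℝ) :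
    HasDerivAt (cutPower δ ε ψ) ((ε : ℂ)⁻¹ * cutPower δ ε (powDeriv δ ψ) u) u := by
  by_cases hu : u / ε ∈ Icc (1 / 2 : ℝ) 2
  · have hu0 : 0 < u := pos_of_div_mem_Icc hε hu
    have huc : (u : ℂ) ≠ 0 := by exact_mod_cast hu0.ne'
    have hεc : (ε : ℂ) ≠ 0 := by exact_mod_cast hε.ne'
    have h1 : HasDerivAt (fun u : ℝ ↦ (u : ℂ) ^ δ) (δ * (u : ℂ) ^ (δ - 1) * 1) u :=
      ((hasDerivAt_id (u : ℂ)).cpow_const (Or.inl (by simpa using hu0))).comp_ofReal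
    have h2 : HasDerivAt (fun u ↦ ψ (u / ε)) ((1 / ε : ℝ) • deriv ψ (u / ε)) u :=
      HasDerivAt.scomp (g₁ := ψ) u (hψ.contDiff.differentiable (by simp) (u / ε)).hasDerivAt
        ((hasDerivAt_id u).div_const ε)
    convert! h1.mul h2 using 1
    rw [Complex.cpow_sub _ _ huc, Complex.cpow_one, cutPower, powDeriv, Complex.real_smul]
    push_cast
    field_simp
  · have h0 := (hψ.powDeriv δ).eventually_cutPower_eq_zero (δ := δ) hu
    rw [h0.self_of_nhds, Pi.zero_apply, mul_zero]
    exact (hasDerivAt_const u (0 : ℂ)).congr_of_eventuallyEq (hψ.eventually_cutPower_eq_zero hu)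

theorem contDiff_cutPower (hψ : IsProfile ψ) (hε : 0 < ε) : ContDiff ℝ ∞ (cutPower δ ε ψ) := by
  rw [contDiff_iff_contDiffAt]
  intro u
  by_cases hu : u / ε ∈ Icc (1 / 2 : ℝ) 2
  · have hu0 : 0 < u := pos_of_div_mem_Icc hε hu
    have h1 : ContDiffAt ℝ ∞ (fun u : ℝ ↦ (u : ℂ) ^ δ) u := by
      have : (fun u : ℝ ↦ (u : ℂ) ^ δ) =ᶠ[nhds u] fun u ↦ Complex.exp ((Real.log u : ℂ) * δ) := by
        filter_upwards [lt_mem_nhds hu0] with w hw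
        rw [Complex.cpow_def_of_ne_zero (by exact_mod_cast hw.ne'), Complex.ofReal_log hw.le]
      refine ContDiffAt.congr_of_eventuallyEq ?_ this
      have hl : ContDiffAt ℝ ∞ Real.log u := Real.contDiffAt_log.2 hu0.ne'
      have hl' : ContDiffAt ℝ ∞ (fun u ↦ (Real.log u : ℂ)) u :=
        Complex.ofRealCLM.contDiff.contDiffAt.comp u hl
      exact (hl'.mul contDiffAt_const).cexp
    have h2 : ContDiff ℝ ∞ fun u ↦ ψ (u / ε) := hψ.contDiff.comp (contDiff_id.div_const ε)
    exact h1.mul h2.contDiffAt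
  · exact (contDiffAt_const (c := (0 : ℂ))).congr_of_eventuallyEq
      (hψ.eventually_cutPower_eq_zero hu)

theorem hasCompactSupport_cutPower_radial (hψ : IsProfile ψ) (hε : 0 < ε) (n : ℕ) :
    HasCompactSupport fun x : EuclideanSpace ℝ (Fin n) ↦ cutPower δ ε ψ (1 - ‖x‖ ^ 2) := by
  refine HasCompactSupport.intro (isCompact_closedBall (0 : EuclideanSpace ℝ (Fin n)) 1) ?_
  intro x hx
  have hx1 : 1 < ‖x‖ := by simpa using hx
  refine (hψ.eventually_cutPower_eq_zero fun h ↦ ?_).self_of_nhds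
  have := pos_of_div_mem_Icc hε h
  nlinarith

/-- The Schwartz function `(1 - |x|²)^δ ψ((1 - |x|²) / ε)`. -/
noncomputable def annulusFun (n : ℕ) (δ : ℂ) (hψ : IsProfile ψ) (hε : 0 < ε) :
    𝓢(EuclideanSpace ℝ (Fin n), ℂ) :=
  (hasCompactSupport_cutPower_radial (δ := δ) hψ hε n).toSchwartzMap
    ((contDiff_cutPower hψ hε).comp (contDiff_const.sub (contDiff_norm_sq ℝ)))

theorem annulusFun_apply (n : ℕ) (hψ : IsProfile ψ) (hε : 0 < ε) (x : EuclideanSpace ℝ (Fin n)) :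
    annulusFun n δ hψ hε x = cutPower δ ε ψ (1 - ‖x‖ ^ 2) := rfl

theorem fderiv_radial {E : Type*} [NormedAddCommGroup E] [InnerProductSpace ℝ E] {F : ℝ → ℂ}
    {F' : ℂ} {x : E} (hF : HasDerivAt F F' (1 - ‖x‖ ^ 2)) (m : E) :
    DifferentiableAt ℝ (fun x : E ↦ F (1 - ‖x‖ ^ 2)) x ∧
    fderiv ℝ (fun x : E ↦ F (1 - ‖x‖ ^ 2)) x m = -2 * inner ℝ x m * F' := by
  have h1 : HasFDerivAt (fun x : E ↦ 1 - ‖x‖ ^ 2) (-(2 • innerSL ℝ x)) x :=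
    (hasStrictFDerivAt_norm_sq x).hasFDerivAt.const_sub 1
  have h2 := hF.hasFDerivAt.comp x h1
  refine ⟨h2.differentiableAt, ?_⟩
  have h3 : fderiv ℝ (fun x : E ↦ F (1 - ‖x‖ ^ 2)) x = _ := h2.fderiv
  rw [h3]
  simp
  ring

/-- Chain rule for u = 1-|x|², with |∇u|² = 4|x|² and Δu = -2n. -/
theorem laplacian_of_radial {n : ℕ} (f : 𝓢(EuclideanSpace ℝ (Fin n), ℂ)) {F F' F'' : ℝ → ℂ}
    (hf : ∀ x, f x = F (1 - ‖x‖ ^ 2)) (hF : ∀ u, HasDerivAt F (F' u) u)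
    (hF' : ∀ u, HasDerivAt F' (F'' u) u) (x : EuclideanSpace ℝ (Fin n)) :
    Δ f x = 4 * (‖x‖ ^ 2 : ℝ) * F'' (1 - ‖x‖ ^ 2) - 2 * n * F' (1 - ‖x‖ ^ 2) := by
  have hline (m x : EuclideanSpace ℝ (Fin n)) :
      ∂_{m} f x = -2 * inner ℝ x m * F' (1 - ‖x‖ ^ 2) := by
    rw [SchwartzMap.lineDerivOp_apply_eq_fderiv, show ⇑f = _ from funext hf]
    exact (fderiv_radial (hF _) m).2
  have hline2 (m x : EuclideanSpace ℝ (Fin n)) : ∂_{m} (∂_{m} f) x =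
      4 * ((inner ℝ x m) ^ 2 : ℝ) * F'' (1 - ‖x‖ ^ 2) - 2 * (‖m‖ ^ 2 : ℝ) * F' (1 - ‖x‖ ^ 2) := by
    rw [SchwartzMap.lineDerivOp_apply_eq_fderiv,
      show ⇑(∂_{m} f : 𝓢(EuclideanSpace ℝ (Fin n), ℂ)) = _ from funext (hline m)]
    have hi : HasFDerivAt (fun x : EuclideanSpace ℝ (Fin n) ↦ (-2 * (inner ℝ x m : ℝ) : ℂ))
        ((-2 : ℂ) • (Complex.ofRealCLM ∘L (innerSL ℝ m))) x := by
      have : HasFDerivAt (fun x : EuclideanSpace ℝ (Fin n) ↦ ((inner ℝ x m : ℝ) : ℂ))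
          (Complex.ofRealCLM ∘L (innerSL ℝ m)) x := by
        convert! (Complex.ofRealCLM ∘L (innerSL ℝ m)).hasFDerivAt using 2 with y
        simp [real_inner_comm]
      exact this.const_mul _
    obtain ⟨hd, hd2⟩ := fderiv_radial (x := x) (hF' _) m
    rw [fderiv_fun_mul hi.differentiableAt hd, hi.fderiv]
    simp only [_root_.add_apply, _root_.smul_apply, hd2, smul_eq_mul]
    simp
    ring
  rw [SchwartzMap.laplacian_eq_sum (EuclideanSpace.basisFun (Fin n) ℝ), _root_.sum_apply]
  simp only [hline2, Finset.sum_sub_distrib, ← Finset.sum_mul, ← Finset.mul_sum,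
    ← Complex.ofReal_sum, OrthonormalBasis.sum_sq_inner_left]
  simp

theorem schwartzBessel_two {n : ℕ} (f : 𝓢(EuclideanSpace ℝ (Fin n), ℂ)) :
    schwartzBessel n 2 f = f - Δ f := by
  have hΔ : Δ f = (-(2 * Real.pi) ^ 2 : ℂ) • SchwartzMap.fourierMultiplierCLM ℂ
      (fun ξ : EuclideanSpace ℝ (Fin n) ↦ ((‖ξ‖ ^ 2 : ℝ) : ℂ)) f := by
    rw [SchwartzMap.laplacian_eq_fourierMultiplierCLM,
      ← SchwartzMap.fourierMultiplierCLM_ofReal ℂ (by fun_prop)]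
    ext x
    simp
  have hF : 𝓕 (Δ f) = (-(2 * Real.pi) ^ 2 : ℂ) • SchwartzMap.smulLeftCLM ℂ
      (fun ξ : EuclideanSpace ℝ (Fin n) ↦ ((‖ξ‖ ^ 2 : ℝ) : ℂ)) (𝓕 f) := by
    rw [hΔ, SchwartzMap.fourierMultiplierCLM_apply, FourierTransform.fourier_smul]
    congr 1
    exact FourierTransform.fourier_fourierInv_eq _
  have key : 𝓕 (schwartzBessel n 2 f) = 𝓕 (f - Δ f) := by
    ext ξ
    have hsub : 𝓕 (f - Δ f) = 𝓕 f - 𝓕 (Δ f) := by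
      simpa using map_sub (FourierTransform.fourierCLM ℂ 𝓢(EuclideanSpace ℝ (Fin n), ℂ)) f (Δ f)
    rw [hsub, hF, fourier_schwartzBessel, besselSymbol_two, _root_.sub_apply,
      _root_.smul_apply, SchwartzMap.smulLeftCLM_apply_apply (by fun_prop)]
    simp only [smul_eq_mul]
    push_cast
    ring
  have h1 : 𝓕⁻ (𝓕 (schwartzBessel n 2 f)) = schwartzBessel n 2 f :=
    FourierTransform.fourierInv_fourier_eq _
  have h2 : 𝓕⁻ (𝓕 (f - Δ f)) = f - Δ f := FourierTransform.fourierInv_fourier_eq _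
  rw [← h1, key, h2]

/-- Put u = εv in the radial Laplacian: |x|² = 1-εv, each derivative in u costs ε^{-1}, and ε^{-2}
factors out. The form of the function is preserved, so the computation can be iterated. -/
theorem schwartzBessel_two_annulusFun (n : ℕ) (hψ : IsProfile ψ) (hε : 0 < ε) :
    schwartzBessel n 2 (annulusFun n δ hψ hε) =
      ((ε : ℂ) ^ 2)⁻¹ • annulusFun n δ (hψ.profileOp n δ ε) hε := by
  ext x
  have hεc : (ε : ℂ) ≠ 0 := by exact_mod_cast hε.ne'
  rw [schwartzBessel_two, _root_.sub_apply, _root_.smul_apply,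
    laplacian_of_radial (annulusFun n δ hψ hε) (annulusFun_apply n hψ hε)
      (fun u ↦ hasDerivAt_cutPower hψ hε u)
      (fun u ↦ (hasDerivAt_cutPower (hψ.powDeriv δ) hε u).const_mul _),
    annulusFun_apply, annulusFun_apply]
  simp only [cutPower, profileOp, smul_eq_mul]
  push_cast
  field_simp
  ring

end Radial

/-! ### L^q and Sobolev bounds for one annular piece -/

section AnnulusNorm

open Set

variable {ψ : ℝ → ℂ} {δ : ℂ} {ε : ℝ}

theorem volume_annulus_le {n : ℕ} (hn : 0 < n) (hε : 0 < ε) :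
    volume {x : EuclideanSpace ℝ (Fin n) | 0 < 1 - ‖x‖ ^ 2 ∧ 1 - ‖x‖ ^ 2 ≤ 2 * ε} ≤
      ENNReal.ofReal
        (2 * n * (volume (Metric.ball (0 : EuclideanSpace ℝ (Fin n)) 1)).toReal * ε) := by
  have : Nonempty (Fin n) := ⟨⟨0, hn⟩⟩
  set V := volume (Metric.ball (0 : EuclideanSpace ℝ (Fin n)) 1) with hV
  have hVt : V ≠ ∞ := measure_ball_lt_top.ne
  set r := max (1 - 2 * ε) 0 with hr
  have hr0 : 0 ≤ r := le_max_right _ _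
  have hr1 : r ≤ 1 := max_le (by linarith) zero_le_one
  have hsub : {x : EuclideanSpace ℝ (Fin n) | 0 < 1 - ‖x‖ ^ 2 ∧ 1 - ‖x‖ ^ 2 ≤ 2 * ε} ⊆
      Metric.ball 0 1 \ Metric.ball 0 r := by
    rintro x ⟨h1, h2⟩
    have hx := norm_nonneg x
    have hx1 : ‖x‖ < 1 := by nlinarith
    refine ⟨by simpa using hx1, ?_⟩
    simp only [mem_ball_zero_iff, not_lt]
    refine max_le ?_ hx
    nlinarith
  -- Bernoulli's inequality if 2ε ≤ 1. Otherwise the left side is at most 1, and 2nε > 1 because n ≥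
  -- 1.
  have hbern : 1 - r ^ n ≤ 2 * n * ε := by
    have hn1 : (1 : ℝ) ≤ n := by exact_mod_cast hn
    by_cases h : 0 ≤ 1 - 2 * ε
    · rw [hr, max_eq_left h]
      have := one_add_mul_le_pow (a := -(2 * ε)) (by linarith) n
      rw [← sub_eq_add_neg] at this
      linarith
    · have : 1 ≤ 2 * n * ε := by nlinarith
      have := pow_nonneg hr0 n
      linarith
  calc _ ≤ volume (Metric.ball (0 : EuclideanSpace ℝ (Fin n)) 1 \ Metric.ball 0 r) :=
        measure_mono hsub
    _ = V - ENNReal.ofReal (r ^ n) * V := by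
        rw [measure_sdiff (Metric.ball_subset_ball hr1) measurableSet_ball.nullMeasurableSet
          measure_ball_lt_top.ne, Measure.addHaar_ball _ _ hr0, finrank_euclideanSpace_fin]
    _ = ENNReal.ofReal ((1 - r ^ n) * V.toReal) := by
        rw [ENNReal.ofReal_mul' ENNReal.toReal_nonneg, ENNReal.ofReal_toReal hVt,
          ENNReal.ofReal_sub _ (by positivity), ENNReal.ofReal_one,
          ENNReal.sub_mul (fun _ _ ↦ hVt), one_mul]
    _ ≤ _ := by
        refine ENNReal.ofReal_le_ofReal ?_
        have := mul_le_mul_of_nonneg_right hbern (ENNReal.toReal_nonneg (a := V))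
        linarith

theorem rpow_le_two_rpow_abs {v : ℝ} (hv : v ∈ Icc (1 / 2 : ℝ) 2) (σ : ℝ) :
    v ^ σ ≤ 2 ^ |σ| := by
  have hv0 : 0 < v := by linarith [hv.1]
  rcases le_total 0 σ with h | h
  · rw [abs_of_nonneg h]
    exact Real.rpow_le_rpow hv0.le hv.2 h
  · rw [abs_of_nonpos h, Real.rpow_neg zero_le_two, ← Real.inv_rpow zero_le_two, ← one_div]
    exact Real.rpow_le_rpow_of_nonpos (by norm_num) hv.1 h

theorem norm_cutPower_le (hψ : IsProfile ψ) (hε : 0 < ε) {M : ℝ} (hM : ∀ v, ‖ψ v‖ ≤ M) (u : ℝ) :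
    ‖cutPower δ ε ψ u‖ ≤ 2 ^ |δ.re| * M * ε ^ δ.re := by
  have hM0 : 0 ≤ M := (norm_nonneg _).trans (hM 0)
  by_cases hu : u / ε ∈ Icc (1 / 2 : ℝ) 2
  · have hu0 := pos_of_div_mem_Icc hε hu
    rw [cutPower, norm_mul, Complex.norm_cpow_eq_rpow_re_of_pos hu0]
    have : u ^ δ.re = (u / ε) ^ δ.re * ε ^ δ.re := by
      rw [← Real.mul_rpow (by positivity) hε.le, div_mul_cancel₀ _ hε.ne']
    rw [this]
    calc _ ≤ 2 ^ |δ.re| * ε ^ δ.re * M := by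
          gcongr
          · exact rpow_le_two_rpow_abs hu _
          · exact hM _
      _ = _ := by ring
  · rw [(hψ.eventually_cutPower_eq_zero hu).self_of_nhds, Pi.zero_apply, norm_zero]
    positivity

/-- Sup norm times the q-th root of the shell's volume: the latter gives the gain 1/q in the
exponent. -/
theorem eLpNorm_annulusFun_le {n : ℕ} (hn : 0 < n) (hψ : IsProfile ψ) (hε : 0 < ε)
    {q : ℝ≥0∞} (hq : q ≠ ∞) (hq1 : 1 ≤ q) {M : ℝ} (hM : ∀ v, ‖ψ v‖ ≤ M) :
    eLpNorm (annulusFun n δ hψ hε) q volume ≤ ENNReal.ofReal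
      ((2 * n * (volume (Metric.ball (0 : EuclideanSpace ℝ (Fin n)) 1)).toReal) ^ (1 / q.toReal) *
        (2 ^ |δ.re| * M) * ε ^ (δ.re + 1 / q.toReal)) := by
  have hM0 : 0 ≤ M := (norm_nonneg _).trans (hM 0)
  have hp : 0 < q.toReal := ENNReal.toReal_pos (zero_lt_one.trans_le hq1).ne' hq
  set A := {x : EuclideanSpace ℝ (Fin n) | 0 < 1 - ‖x‖ ^ 2 ∧ 1 - ‖x‖ ^ 2 ≤ 2 * ε} with hA
  have hsupp : Function.support (annulusFun n δ hψ hε) ⊆ A := by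
    intro x hx
    by_contra hxA
    refine hx ?_
    rw [annulusFun_apply]
    refine (hψ.eventually_cutPower_eq_zero fun h ↦ hxA ?_).self_of_nhds
    exact ⟨pos_of_div_mem_Icc hε h, (div_le_iff₀ hε).1 h.2⟩
  rw [← eLpNorm_restrict_eq_of_support_subset hsupp]
  refine (eLpNorm_le_of_ae_bound (C := 2 ^ |δ.re| * M * ε ^ δ.re)
    (.of_forall fun x ↦ norm_cutPower_le hψ hε hM _)).trans ?_
  rw [Measure.restrict_apply_univ]
  set V := (volume (Metric.ball (0 : EuclideanSpace ℝ (Fin n)) 1)).toReal with hV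
  have hV0 : 0 ≤ V := ENNReal.toReal_nonneg
  calc _ ≤ ENNReal.ofReal (2 * n * V * ε) ^ q.toReal⁻¹ *
        ENNReal.ofReal (2 ^ |δ.re| * M * ε ^ δ.re) := by
        gcongr
        exact volume_annulus_le hn hε
    _ = _ := by
        rw [ENNReal.ofReal_rpow_of_nonneg (by positivity) (by positivity),
          ← ENNReal.ofReal_mul (by positivity), Real.mul_rpow (by positivity) hε.le,
          Real.rpow_add hε, one_div]
        congr 1
        ring

theorem IsProfile.iterate_profileOp (hψ : IsProfile ψ) (n : ℕ) (δ : ℂ) (ε : ℝ) (j : ℕ) :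
    IsProfile ((BochnerRiesz.profileOp n δ ε)^[j] ψ) := by
  induction j with
  | zero => exact hψ
  | succ j ih =>
    rw [Function.iterate_succ_apply']
    exact ih.profileOp n δ ε

theorem profileFamily_iterate (hψ : IsProfile ψ) (n j : ℕ) :
    ProfileFamily fun δ ε ↦ (profileOp n δ ε)^[j] ψ := by
  induction j with
  | zero => exact .const hψ
  | succ j ih =>
    simp only [Function.iterate_succ_apply']
    exact ih.profileOp n

theorem schwartzBessel_even_annulusFun (n : ℕ) (hψ : IsProfile ψ) (hε : 0 < ε) (j : ℕ) :
    schwartzBessel n (2 * j) (annulusFun n δ hψ hε) =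
      ((ε : ℂ) ^ (2 * j))⁻¹ • annulusFun n δ (hψ.iterate_profileOp n δ ε j) hε := by
  induction j with
  | zero =>
    ext x
    simp [schwartzBessel_zero, annulusFun_apply]
  | succ j ih =>
    rw [show (2 * ((j + 1 : ℕ) : ℝ)) = 2 + 2 * (j : ℝ) by push_cast; ring, schwartzBessel_add, ih,
      map_smul, schwartzBessel_two_annulusFun]
    ext x
    simp only [_root_.smul_apply, annulusFun_apply, smul_eq_mul, Function.iterate_succ_apply']
    rw [← mul_assoc, ← mul_inv, ← pow_add, mul_add, mul_one]

theorem eLpNorm_schwartzBessel_even_annulusFun_le {n : ℕ} (hn : 0 < n) (hψ : IsProfile ψ)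
    {q : ℝ≥0∞} (hq : q ≠ ∞) (hq1 : 1 ≤ q) (j : ℕ) (m : ℝ) :
    ∃ C : ℝ, 0 ≤ C ∧ ∀ (σ τ ε : ℝ) (hε : 0 < ε), |σ| ≤ m → ε ≤ 1 →
      eLpNorm (schwartzBessel n (2 * j) (annulusFun n (σ + τ * Complex.I) hψ hε)) q volume ≤
        ENNReal.ofReal (C * Real.exp |τ| * ε ^ (σ + 1 / q.toReal - 2 * j)) := by
  obtain ⟨C, hC0, N, hC⟩ := (profileFamily_iterate hψ n j).exists_bound
  set K := (2 * n * (volume (Metric.ball (0 : EuclideanSpace ℝ (Fin n)) 1)).toReal) ^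
    (1 / q.toReal) with hK
  have hK0 : 0 ≤ K := by positivity
  refine ⟨K * (2 ^ m * (C * (N.factorial * Real.exp (1 + m)))), by positivity,
    fun σ τ ε hε hσ hε1 ↦ ?_⟩
  set δ : ℂ := σ + τ * Complex.I with hδ
  have hre : δ.re = σ := by simp [hδ]
  have hnorm : ‖δ‖ ≤ m + |τ| := by
    refine (norm_add_le _ _).trans (add_le_add ?_ ?_)
    · simpa using hσ
    · simp
  have hm0 : 0 ≤ m := (abs_nonneg σ).trans hσ
  -- The polynomial in |δ| is absorbed through x^N ≤ N! e^x; this is why e^{|τ|} suffices whatever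
  -- the degree N.
  have hpow : (1 + ‖δ‖) ^ N ≤ N.factorial * Real.exp (1 + m) * Real.exp |τ| := by
    calc (1 + ‖δ‖) ^ N ≤ (1 + m + |τ|) ^ N := pow_le_pow_left₀ (by positivity) (by linarith) N
      _ ≤ N.factorial * Real.exp (1 + m + |τ|) := by
          have := Real.pow_div_factorial_le_exp (1 + m + |τ|) (by positivity) N
          rw [div_le_iff₀ (by positivity)] at this
          linarith
      _ = _ := by rw [Real.exp_add]; ring
  have hb := eLpNorm_annulusFun_le (δ := δ) hn (hψ.iterate_profileOp n δ ε j) hε hq hq1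
    (fun v ↦ hC δ ε v hε.le hε1)
  rw [hre] at hb
  rw [schwartzBessel_even_annulusFun, show ⇑(((ε : ℂ) ^ (2 * j))⁻¹ •
    annulusFun n δ (hψ.iterate_profileOp n δ ε j) hε) = ((ε : ℂ) ^ (2 * j))⁻¹ •
      ⇑(annulusFun n δ (hψ.iterate_profileOp n δ ε j) hε) from rfl, eLpNorm_const_smul]
  have hn2 : ‖((ε : ℂ) ^ (2 * j))⁻¹‖ₑ = ENNReal.ofReal (ε ^ (-(2 * j : ℝ))) := by
    rw [← ofReal_norm, norm_inv, norm_pow, Complex.norm_real, Real.norm_of_nonneg hε.le,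
      Real.rpow_neg hε.le]
    congr 2
    exact_mod_cast (Real.rpow_natCast ε (2 * j)).symm
  rw [hn2]
  calc _ ≤ ENNReal.ofReal (ε ^ (-(2 * j : ℝ))) * ENNReal.ofReal (K * (2 ^ |σ| *
        (C * (1 + ‖δ‖) ^ N)) * ε ^ (σ + 1 / q.toReal)) := by gcongr
    _ ≤ ENNReal.ofReal (ε ^ (-(2 * j : ℝ))) * ENNReal.ofReal (K * (2 ^ m *
        (C * (N.factorial * Real.exp (1 + m) * Real.exp |τ|))) * ε ^ (σ + 1 / q.toReal)) := by
        gcongr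
        exact one_le_two
    _ = _ := by
        rw [← ENNReal.ofReal_mul (by positivity), sub_eq_add_neg (σ + 1 / q.toReal),
          Real.rpow_add hε (σ + 1 / q.toReal)]
        congr 1
        ring

theorem eLpNorm_schwartzBessel_annulusFun_le {n : ℕ} (hn : 0 < n) (hψ : IsProfile ψ)
    {q : ℝ≥0∞} (hq : q ≠ ∞) (hq1 : 1 ≤ q) {s : ℝ} (hs : 0 ≤ s) (m : ℝ) :
    ∃ C : ℝ, 0 ≤ C ∧ ∀ (σ τ ε : ℝ) (hε : 0 < ε), |σ| ≤ m → ε ≤ 1 →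
      eLpNorm (schwartzBessel n s (annulusFun n (σ + τ * Complex.I) hψ hε)) q volume ≤
        ENNReal.ofReal (C * Real.exp |τ| * ε ^ (σ + 1 / q.toReal - s)) := by
  set j := ⌊s / 2⌋₊ with hj
  obtain ⟨C₀, hC₀, h₀⟩ := eLpNorm_schwartzBessel_even_annulusFun_le hn hψ hq hq1 j m
  obtain ⟨C₁, hC₁, h₁⟩ := eLpNorm_schwartzBessel_even_annulusFun_le hn hψ hq hq1 (j + 1) m
  have hjle : (j : ℝ) ≤ s / 2 := Nat.floor_le (by linarith)
  have hjlt : s / 2 < j + 1 := Nat.lt_floor_add_one _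
  -- If s/2 is an integer there is nothing to interpolate, and a = 0 would be excluded from the
  -- interpolation inequality.
  rcases hjle.eq_or_lt with he | hlt
  · refine ⟨C₀, hC₀, fun σ τ ε hε hσ hε1 ↦ ?_⟩
    have : s = 2 * j := by linarith
    rw [this]
    exact h₀ σ τ ε hε hσ hε1
  obtain ⟨a, ha⟩ : ∃ a, a = s / 2 - j := ⟨_, rfl⟩
  have ha0 : 0 < a := by linarith
  have ha1 : a < 1 := by linarith
  have hΓ : 0 < Real.Gamma (1 - a) := Real.Gamma_pos_of_pos (by linarith)
  have h1a : 0 < 1 - a := by linarith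
  refine ⟨(Real.Gamma (1 - a))⁻¹ * (C₁ / (1 - a) + 2 * C₀), by positivity,
    fun σ τ ε hε hσ hε1 ↦ ?_⟩
  set f := annulusFun n (σ + τ * Complex.I) hψ hε with hf
  -- T = ε² balances the two terms: T^{1-a} ε^{-2(j+1)} and T^{-a} ε^{-2j} both equal ε^{-s}, as s =
  -- 2j+2a.
  have hT : 0 < ε ^ (2 : ℝ) := by positivity
  have hint := eLpNorm_schwartzBessel_le ha0 ha1 hT hq1 hq (schwartzBessel n (2 * j) f)
  rw [← schwartzBessel_add, ← schwartzBessel_add, show 2 * a + 2 * (j : ℝ) = s by rw [ha]; ring,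
    show 2 + 2 * (j : ℝ) = 2 * ((j + 1 : ℕ) : ℝ) by push_cast; ring] at hint
  have e1 : (ε ^ (2 : ℝ)) ^ (1 - a) * ε ^ (σ + 1 / q.toReal - 2 * ((j + 1 : ℕ) : ℝ)) =
      ε ^ (σ + 1 / q.toReal - s) := by
    rw [← Real.rpow_mul hε.le, ← Real.rpow_add hε]
    congr 1
    rw [ha]; push_cast; ring
  have e0 : (ε ^ (2 : ℝ)) ^ (-a) * ε ^ (σ + 1 / q.toReal - 2 * (j : ℝ)) =
      ε ^ (σ + 1 / q.toReal - s) := by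
    rw [← Real.rpow_mul hε.le, ← Real.rpow_add hε]
    congr 1
    rw [ha]; ring
  refine hint.trans ?_
  calc _ ≤ ENNReal.ofReal (Real.Gamma (1 - a))⁻¹ *
        (ENNReal.ofReal ((ε ^ (2 : ℝ)) ^ (1 - a) / (1 - a)) *
          ENNReal.ofReal (C₁ * Real.exp |τ| * ε ^ (σ + 1 / q.toReal - 2 * ((j + 1 : ℕ) : ℝ))) +
        ENNReal.ofReal 2 * (ENNReal.ofReal ((ε ^ (2 : ℝ)) ^ (-a)) *
          ENNReal.ofReal (C₀ * Real.exp |τ| * ε ^ (σ + 1 / q.toReal - 2 * (j : ℝ))))) := by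
        rw [ENNReal.ofReal_ofNat]
        gcongr
        · exact h₁ σ τ ε hε hσ hε1
        · exact h₀ σ τ ε hε hσ hε1
    _ = _ := by
        rw [← ENNReal.ofReal_mul (by positivity), ← ENNReal.ofReal_mul (by positivity),
          ← ENNReal.ofReal_mul (by positivity), ← ENNReal.ofReal_add (by positivity)
          (by positivity), ← ENNReal.ofReal_mul (by positivity)]
        congr 1
        calc _ = (Real.Gamma (1 - a))⁻¹ * (C₁ / (1 - a) * Real.exp |τ| *
              ((ε ^ (2 : ℝ)) ^ (1 - a) * ε ^ (σ + 1 / q.toReal - 2 * ((j + 1 : ℕ) : ℝ))) +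
              2 * C₀ * Real.exp |τ| *
              ((ε ^ (2 : ℝ)) ^ (-a) * ε ^ (σ + 1 / q.toReal - 2 * (j : ℝ)))) := by ring
          _ = _ := by rw [e1, e0]; ring

end AnnulusNorm

/-! ### Dyadic decomposition and summation -/

section Decomposition

open Set Filter

/-- A smooth function equal to `1` on `(-∞, 1]` and to `0` on `[2, ∞)`. -/
noncomputable def stepDown (v : ℝ) : ℝ := Real.smoothTransition (2 - v)

/-- The dyadic cutoff, a profile whose dilates by powers of `2` sum to one. -/
noncomputable def dyadicCutoff (v : ℝ) : ℂ := ((stepDown v - stepDown (2 * v) : ℝ) : ℂ)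

theorem stepDown_of_le_one {v : ℝ} (hv : v ≤ 1) : stepDown v = 1 :=
  Real.smoothTransition.one_of_one_le (by linarith)

theorem stepDown_of_two_le {v : ℝ} (hv : 2 ≤ v) : stepDown v = 0 :=
  Real.smoothTransition.zero_of_nonpos (by linarith)

theorem isProfile_dyadicCutoff : IsProfile dyadicCutoff where
  contDiff := by
    have h : ContDiff ℝ (⊤ : ℕ∞) stepDown :=
      Real.smoothTransition.contDiff.comp (contDiff_const.sub contDiff_id)
    exact Complex.ofRealCLM.contDiff.comp (h.sub (h.comp (contDiff_const.mul contDiff_id)))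
  eq_zero v hv := by
    rw [dyadicCutoff]
    rcases lt_or_ge v (1 / 2) with h | h
    · rw [stepDown_of_le_one (by linarith), stepDown_of_le_one (by linarith), sub_self,
        Complex.ofReal_zero]
    · have h2 : 2 < v := by
        by_contra h2
        exact hv ⟨h, not_lt.1 h2⟩
      rw [stepDown_of_two_le h2.le, stepDown_of_two_le (by linarith), sub_self,
        Complex.ofReal_zero]

theorem sum_dyadicCutoff (u : ℝ) (K : ℕ) :
    ∑ k ∈ Finset.range K, dyadicCutoff (u / (1 / 2) ^ k) =
      ((stepDown u - stepDown (2 ^ K * u) : ℝ) : ℂ) := by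
  have h (k : ℕ) : dyadicCutoff (u / (1 / 2) ^ k) =
      ((stepDown (2 ^ k * u) : ℝ) : ℂ) - ((stepDown (2 ^ (k + 1) * u) : ℝ) : ℂ) := by
    rw [dyadicCutoff, Complex.ofReal_sub, one_div, inv_pow, div_inv_eq_mul, mul_comm u,
      ← mul_assoc, ← pow_succ']
  simp only [h]
  rw [Finset.sum_range_sub' fun k ↦ ((stepDown (2 ^ k * u) : ℝ) : ℂ)]
  simp

variable {n : ℕ}

/-- The dyadic pieces of `(1 - |x|²)_+^δ`. -/
noncomputable def dyadicPiece (n : ℕ) (δ : ℂ) (k : ℕ) : 𝓢(EuclideanSpace ℝ (Fin n), ℂ) :=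
  annulusFun n δ isProfile_dyadicCutoff (ε := (1 / 2) ^ k) (by positivity)

/-- At each point the partial sums telescope and are eventually constant: 1-|x|² ≤ 1 makes the first
step equal 1, and for |x| < 1 the last one vanishes once 2^K (1-|x|²) ≥ 2. -/
theorem tendsto_sum_dyadicPiece (δ : ℂ) (x : EuclideanSpace ℝ (Fin n)) :
    Tendsto (fun K ↦ ∑ k ∈ Finset.range K, dyadicPiece n δ k x) atTop
      (nhds (ballPower n δ x)) := by
  refine tendsto_const_nhds.congr' ?_
  by_cases hx : ‖x‖ < 1
  · have hu : 0 < 1 - ‖x‖ ^ 2 := by nlinarith [norm_nonneg x]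
    have hlim : Tendsto (fun K : ℕ ↦ (2 : ℝ) ^ K * (1 - ‖x‖ ^ 2)) atTop atTop :=
      (tendsto_pow_atTop_atTop_of_one_lt one_lt_two).atTop_mul_const hu
    filter_upwards [hlim.eventually_ge_atTop 2] with K hK
    simp only [dyadicPiece, annulusFun_apply, cutPower]
    rw [← Finset.mul_sum, sum_dyadicCutoff, stepDown_of_two_le hK,
      stepDown_of_le_one (by nlinarith [norm_nonneg x]), ballPower, if_pos hx]
    simp
  · refine Eventually.of_forall fun K ↦ ?_
    rw [ballPower, if_neg hx]
    refine (Finset.sum_eq_zero fun k _ ↦ ?_).symm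
    rw [dyadicPiece, annulusFun_apply]
    refine (isProfile_dyadicCutoff.eventually_cutPower_eq_zero fun h ↦ ?_).self_of_nhds
    have := pos_of_div_mem_Icc (by positivity) h
    nlinarith

theorem besselOp_toLp (s : ℝ) (q : ℝ≥0∞) [Fact (1 ≤ q)] (f : 𝓢(EuclideanSpace ℝ (Fin n), ℂ)) :
    besselOp n s (Lp.toTemperedDistributionCLM ℂ volume q (f.toLp q)) =
      Lp.toTemperedDistributionCLM ℂ volume q ((schwartzBessel n s f).toLp q) := by
  rw [Lp.toTemperedDistributionCLM_apply, Lp.toTemperedDistributionCLM_apply,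
    Lp.toTemperedDistribution_toLp_eq, Lp.toTemperedDistribution_toLp_eq]
  exact TemperedDistribution.fourierMultiplierCLM_toTemperedDistributionCLM_eq
    (besselSymbol_hasTemperateGrowth n s) f

/-- Norm convergence gives almost everywhere convergence along a subsequence, whose limit must be
the pointwise one. -/
theorem ae_eq_of_hasSum_toLp {q : ℝ≥0∞} [Fact (1 ≤ q)]
    {S : ℕ → 𝓢(EuclideanSpace ℝ (Fin n), ℂ)}
    {F : Lp ℂ q (volume : Measure (EuclideanSpace ℝ (Fin n)))}
    (hF : HasSum (fun k ↦ (S k).toLp q) F) {f : EuclideanSpace ℝ (Fin n) → ℂ}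
    (hf : ∀ x, Tendsto (fun K ↦ ∑ k ∈ Finset.range K, S k x) atTop (nhds (f x))) :
    F =ᵐ[volume] f := by
  have hm := tendstoInMeasure_of_tendsto_Lp hF.tendsto_sum_nat
  obtain ⟨ns, hns, hae⟩ := hm.exists_seq_tendsto_ae
  have hsum (K : ℕ) : ⇑(∑ k ∈ Finset.range K, (S k).toLp q : Lp ℂ q volume) =ᵐ[volume]
      fun x ↦ ∑ k ∈ Finset.range K, S k x := by
    have : ∑ k ∈ Finset.range K, (S k).toLp q = (∑ k ∈ Finset.range K, S k).toLp q :=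
      (map_sum (SchwartzMap.toLpCLM ℂ ℂ q volume) S (Finset.range K)).symm
    rw [this]
    filter_upwards [(∑ k ∈ Finset.range K, S k).coeFn_toLp q] with x hx
    rw [hx, _root_.sum_apply]
  filter_upwards [hae, ae_all_iff.2 hsum] with x hx hx'
  refine tendsto_nhds_unique hx ?_
  simp only [hx']
  exact (hf x).comp hns.tendsto_atTop

/-- A norm-convergent dyadic decomposition yields the image under `(I - Δ)^{s/2}`. -/
theorem exists_isBesselImage_of_hasSum {s : ℝ} {q : ℝ≥0∞} [Fact (1 ≤ q)]
    {S : ℕ → 𝓢(EuclideanSpace ℝ (Fin n), ℂ)} {f : EuclideanSpace ℝ (Fin n) → ℂ}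
    (hf : ∀ x, Tendsto (fun K ↦ ∑ k ∈ Finset.range K, S k x) atTop (nhds (f x)))
    (hS : Summable fun k ↦ (S k).toLp q)
    {G : Lp ℂ q (volume : Measure (EuclideanSpace ℝ (Fin n)))}
    (hG : HasSum (fun k ↦ (schwartzBessel n s (S k)).toLp q) G) :
    IsBesselImage n s q f G := by
  obtain ⟨F, hF⟩ := hS
  have hae := ae_eq_of_hasSum_toLp hF hf
  have hmem : MemLp f q volume := (memLp_congr_ae hae).1 (Lp.memLp F)
  refine ⟨hmem, ?_⟩
  have hFf : hmem.toLp f = F := by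
    rw [← Lp.toLp_coeFn F (Lp.memLp F)]
    exact MemLp.toLp_congr _ _ hae.symm
  have h1 := (hF.mapL (Lp.toTemperedDistributionCLM ℂ volume q)).mapL (besselOp n s)
  have h2 := hG.mapL (Lp.toTemperedDistributionCLM ℂ volume q)
  simp only [besselOp_toLp] at h1
  rw [hFf]
  exact h1.unique h2

theorem norm_toLp_le {q : ℝ≥0∞} {f : 𝓢(EuclideanSpace ℝ (Fin n), ℂ)} {r : ℝ} (hr : 0 ≤ r)
    (h : eLpNorm f q volume ≤ ENNReal.ofReal r) : ‖f.toLp q‖ ≤ r := by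
  rw [SchwartzMap.norm_toLp]
  exact ENNReal.toReal_le_of_le_ofReal hr h

theorem exists_isBesselImage_ballPower (hn : 0 < n) {q : ℝ≥0∞} [hq1 : Fact (1 ≤ q)] (hq : q ≠ ∞)
    {s : ℝ} (hs : 0 < s) {σ₀ c' : ℝ} (hσ₀ : s < σ₀ + 1 / q.toReal) :
    ∃ C : ℝ, 0 < C ∧ ∀ σ τ : ℝ, σ₀ ≤ σ → σ ≤ c' →
      ∃ G, IsBesselImage n s q (ballPower n (σ + τ * Complex.I)) G ∧
        ‖G‖ ≤ C * Real.exp |τ| := by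
  set m := max |σ₀| |c'| with hm
  obtain ⟨C₀, hC₀, h₀⟩ := eLpNorm_schwartzBessel_annulusFun_le hn isProfile_dyadicCutoff hq hq1.out
    le_rfl m
  obtain ⟨C₁, hC₁, h₁⟩ := eLpNorm_schwartzBessel_annulusFun_le hn isProfile_dyadicCutoff hq hq1.out
    hs.le m
  obtain ⟨ρ, hρ⟩ : ∃ ρ : ℝ, ρ = (1 / 2) ^ (σ₀ + 1 / q.toReal - s) := ⟨_, rfl⟩
  have hρ0 : 0 ≤ ρ := by rw [hρ]; positivity
  have hρ1 : ρ < 1 := by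
    rw [hρ]
    exact Real.rpow_lt_one (by norm_num) (by norm_num) (by linarith)
  -- One ratio ρ serves both series: the exponents σ+1/q and σ+1/q-s are each at least σ₀+1/q-s,
  -- since s > 0.
  have hpow (k : ℕ) {e : ℝ} (he : σ₀ + 1 / q.toReal - s ≤ e) :
      ((1 / 2 : ℝ) ^ k) ^ e ≤ ρ ^ k := by
    rw [hρ, ← Real.rpow_natCast, ← Real.rpow_natCast, ← Real.rpow_mul (by norm_num),
      ← Real.rpow_mul (by norm_num), mul_comm (k : ℝ)]
    exact Real.rpow_le_rpow_of_exponent_ge (by norm_num) (by norm_num)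
      (mul_le_mul_of_nonneg_right he (Nat.cast_nonneg k))
  have hgeo := hasSum_geometric_of_lt_one hρ0 hρ1
  have hinv : 0 < (1 - ρ)⁻¹ := inv_pos.2 (by linarith)
  -- The added 1 only ensures a positive constant, as C₁ may be 0.
  refine ⟨(C₁ + 1) * (1 - ρ)⁻¹, by positivity, fun σ τ hσ hσ' ↦ ?_⟩
  have hσm : |σ| ≤ m := abs_le_max_abs_abs hσ hσ'
  have hε (k : ℕ) : (0 : ℝ) < (1 / 2) ^ k := by positivity
  have hε1 (k : ℕ) : (1 / 2 : ℝ) ^ k ≤ 1 := pow_le_one₀ (by norm_num) (by norm_num)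
  have hb₀ (k : ℕ) : ‖(dyadicPiece n (σ + τ * Complex.I) k).toLp q‖ ≤
      C₀ * Real.exp |τ| * ρ ^ k := by
    have h := h₀ σ τ _ (hε k) hσm (hε1 k)
    rw [schwartzBessel_zero] at h
    refine (norm_toLp_le (by positivity) h).trans ?_
    gcongr
    exact hpow k (by linarith)
  have hb₁ (k : ℕ) : ‖(schwartzBessel n s (dyadicPiece n (σ + τ * Complex.I) k)).toLp q‖ ≤
      C₁ * Real.exp |τ| * ρ ^ k := by
    refine (norm_toLp_le (by positivity) (h₁ σ τ _ (hε k) hσm (hε1 k))).trans ?_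
    gcongr
    exact hpow k (by linarith)
  have hs₀ := Summable.of_norm_bounded (hgeo.summable.mul_left _) hb₀
  have hs₁ := Summable.of_norm_bounded (hgeo.summable.mul_left _) hb₁
  refine ⟨_, exists_isBesselImage_of_hasSum (tendsto_sum_dyadicPiece _) hs₀ hs₁.hasSum, ?_⟩
  refine (tsum_of_norm_bounded (hgeo.mul_left _) hb₁).trans ?_
  have := mul_nonneg (Real.exp_pos |τ|).le hinv.le
  nlinarith

end Decomposition

end BochnerRiesz

theorem mainTheorem10 (n : ℕ) (hn : 0 < n) (q : ℝ≥0∞) [Fact (1 ≤ q)] (hq : q ≠ ∞)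
    (s : ℝ) (hs : 0 < s) :
    (∀ σ τ : ℝ, s < σ + 1 / q.toReal →
      BochnerRiesz.MemSobolevW n s q (BochnerRiesz.ballPower n (σ + τ * Complex.I))) ∧
    ∃ c : ℝ, 0 < c ∧ ∀ σ₀ c' : ℝ, s < σ₀ + 1 / q.toReal →
      ∃ C : ℝ, 0 < C ∧ ∀ σ τ : ℝ, σ₀ ≤ σ → σ ≤ c' →
        BochnerRiesz.sobolevNormW n s q (BochnerRiesz.ballPower n (σ + τ * Complex.I)) ≤
          ENNReal.ofReal (C * Real.exp (c * |τ|)) := by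
  constructor
  · intro σ τ h
    obtain ⟨_, _, hC⟩ := BochnerRiesz.exists_isBesselImage_ballPower (c' := σ) hn hq hs h
    obtain ⟨G, hG, _⟩ := hC σ τ le_rfl le_rfl
    exact ⟨G, hG⟩
  -- c = 1 works for all n, q and s.
  · refine ⟨1, one_pos, fun σ₀ c' h ↦ ?_⟩
    obtain ⟨C, hC0, hC⟩ := BochnerRiesz.exists_isBesselImage_ballPower (c' := c') hn hq hs h
    refine ⟨C, hC0, fun σ τ hσ hσ' ↦ ?_⟩
    obtain ⟨G, hG, hle⟩ := hC σ τ hσ hσ'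
    rw [BochnerRiesz.sobolevNormW_eq hG, one_mul, ← ofReal_norm]
    exact ENNReal.ofReal_le_ofReal hle
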